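/- **Setting.** Let $\Omega$ be a nonempty set, $\mathscr A$ an algebra of subsets of $\Omega$, and $\Pi(\mathscr A)$ the collection of all finite partitions of $\Omega$ into elements of $\mathscr A$. Let $\mathrm{Prob}(\mathscr A)$ be the set of finitely additive probabilities on $\mathscr A$. Let $(W,\mathscr B,P)$ be a (countably additive) probability space and $X=L^1(W,\mathscr B,P)$ (real-valued). Let $ba_0(\mathscr A,X)$ be the space of all finitely additive set functions $F:\mathscr A\to X$ with $$\|F\|=\sup_{\pi\in\Pi(\mathscr A)}\Big\|\sum_{A\in\pi}|F(A)|\Big\|_X<\infty ,$$ ordered by $F\le G$ iff $F(A)\le G(A)$ for all $A\in\mathscr A$; $ba_0(\mathscr A,X)_+$ denotes its positive elements, and $|F|$ denotes the least upper bound of $\{F,-F\}$ in $ba_0(\mathscr A,X)$. **Theorem.** Let $(F_n)_n$ be a sequence in $ba_0(\mathscr A,X)_+$ with $\sup_n\|F_n\|<\infty$, and let $\lambda\in\mathrm{Prob}(\mathscr A)$ be such that the set of $[0,\infty]$-valued functions $$\mathcal R=\mathrm{co}\Big\{\sup_{A\in\pi}\frac{F_n(A)}{\lambda(A)}\;:\;n\in\mathbb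 N,\ \pi\in\Pi(\mathscr A)\Big\}$$ (with the conventions $0/0=0$ and $c/0=\infty$ for $c>0$) is $P$-bounded, that is, $\lim_{c\to\infty}\sup_{f\in\mathcal R}P(f>c)=0$. Then there exist $\xi\in ba_0(\mathscr A,X)_+$ and a sequence $(G_n)_n$ with $G_n\in\mathrm{co}(F_n,F_{n+1},\dots)$ for each $n$ such that the modulus $|G_n-\xi|$ exists in $ba_0(\mathscr A,X)$ for each $n$ and $$\lim_n|G_n-\xi|(\Omega)=0\qquad P\text{-almost surely}.$$ -/

import Mathlib

open MeasureTheory Filter Topology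
open scoped ENNReal NNReal

noncomputable section

/-- Multiplication by a nonnegative real is monotone in `L¹(P)`. -/
instance instIsOrderedModuleL1 {W : Type*} [MeasurableSpace W] (P : Measure W) :
    IsOrderedModule ℝ (Lp ℝ 1 P) :=
  IsOrderedModule.of_smul_nonneg fun c hc f hf => by
    rw [← Lp.coeFn_nonneg] at hf ⊢
    filter_upwards [hf, Lp.coeFn_smul c f] with w hw hcf
    rw [hcf]
    exact mul_nonneg hc hw

/-- A set function on the algebra `𝒜` of subsets of `Ω` is finitely additive.
(An algebra of subsets of `Ω` is a `BooleanSubalgebra (Set Ω)`: `⊤` is `Ω`, `⊥` is `∅`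
and `⊔` is the union.) -/
def IsFinAdd {Ω : Type*} {𝒜 : BooleanSubalgebra (Set Ω)} {X : Type*} [Add X]
    (F : 𝒜 → X) : Prop :=
  ∀ A B : 𝒜, Disjoint A B → F (A ⊔ B) = F A + F B

/-- `Prob(𝒜)`: the finitely additive probabilities on `𝒜`. -/
def FinAddProb {Ω : Type*} (𝒜 : BooleanSubalgebra (Set Ω)) : Set (𝒜 → ℝ) :=
  {l | IsFinAdd l ∧ (∀ A, 0 ≤ l A) ∧ l ⊤ = 1}

/-- `ba₀(𝒜, X)`: the finitely additive `F : 𝒜 → X` for which the norms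
`‖∑_{A ∈ π} |F A|‖` are bounded over all finite partitions `π` of `Ω` into elements of `𝒜`.
The order it inherits from `𝒜 → X` is `F ≤ G ↔ ∀ A, F A ≤ G A`. -/
def ba0 {Ω : Type*} (𝒜 : BooleanSubalgebra (Set Ω)) (X : Type*) [NormedAddCommGroup X]
    [Lattice X] [HasSolidNorm X] [IsOrderedAddMonoid X] [NormedSpace ℝ X] [IsOrderedModule ℝ X] :
    Submodule ℝ (𝒜 → X) where
  carrier := {F | IsFinAdd F ∧
    ∃ C : ℝ, ∀ π : Finpartition (⊤ : 𝒜), ‖∑ A ∈ π.parts, |F A|‖ ≤ C}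
  add_mem' := by
    rintro F G ⟨hF, C, hC⟩ ⟨hG, D, hD⟩
    refine ⟨fun A B h => ?_, C + D, fun π => ?_⟩
    · simp only [Pi.add_apply, hF A B h, hG A B h]; abel
    · have hle : ∑ A ∈ π.parts, |(F + G) A| ≤ ∑ A ∈ π.parts, |F A| + ∑ A ∈ π.parts, |G A| := by
        rw [← Finset.sum_add_distrib]
        exact Finset.sum_le_sum fun A _ => abs_add_le _ _
      have h0 : 0 ≤ ∑ A ∈ π.parts, |(F + G) A| := Finset.sum_nonneg fun A _ => abs_nonneg _
      have hn : ‖∑ A ∈ π.parts, |(F + G) A|‖ ≤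
          ‖∑ A ∈ π.parts, |F A| + ∑ A ∈ π.parts, |G A|‖ := by
        apply norm_le_norm_of_abs_le_abs
        rwa [abs_of_nonneg h0, abs_of_nonneg (h0.trans hle)]
      exact hn.trans ((norm_add_le _ _).trans (add_le_add (hC π) (hD π)))
  zero_mem' := ⟨fun A B _ => by simp, 0, fun π => by simp⟩
  smul_mem' := by
    rintro c F ⟨hF, C, hC⟩
    refine ⟨fun A B h => ?_, |c| * C, fun π => ?_⟩
    · simp only [Pi.smul_apply, hF A B h, smul_add]
    · have key : ∀ x : X, |(c • x)| ≤ |c| • |x| := by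
        intro x
        have hx : ∀ d : ℝ, 0 ≤ d → ∀ y : X, |(d • y)| ≤ d • |y| := by
          intro d hd y
          refine sup_le (smul_le_smul_of_nonneg_left (le_abs_self y) hd) ?_
          rw [← smul_neg]
          exact smul_le_smul_of_nonneg_left (neg_le_abs y) hd
        rcases le_total 0 c with h | h
        · rw [abs_of_nonneg h]; exact hx c h x
        · have := hx (-c) (neg_nonneg.mpr h) x
          rwa [neg_smul, abs_neg, ← abs_of_nonpos h] at this
      have hle : ∑ A ∈ π.parts, |(c • F) A| ≤ |c| • ∑ A ∈ π.parts, |F A| := by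
        rw [Finset.smul_sum]
        exact Finset.sum_le_sum fun A _ => key _
      have h0 : 0 ≤ ∑ A ∈ π.parts, |(c • F) A| := Finset.sum_nonneg fun A _ => abs_nonneg _
      have hn : ‖∑ A ∈ π.parts, |(c • F) A|‖ ≤ ‖|c| • ∑ A ∈ π.parts, |F A|‖ := by
        apply norm_le_norm_of_abs_le_abs
        rwa [abs_of_nonneg h0, abs_of_nonneg (h0.trans hle)]
      refine hn.trans ?_
      rw [norm_smul, Real.norm_eq_abs, abs_abs]
      exact mul_le_mul_of_nonneg_left (hC π) (abs_nonneg c)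

/-- The norm of `ba₀(𝒜, X)`: `‖F‖ = sup_π ‖∑_{A ∈ π} |F A|‖`. -/
def ba0Norm {Ω : Type*} {𝒜 : BooleanSubalgebra (Set Ω)} {X : Type*} [NormedAddCommGroup X]
    [Lattice X] [HasSolidNorm X] [IsOrderedAddMonoid X] [NormedSpace ℝ X] [IsOrderedModule ℝ X]
    (F : ba0 𝒜 X) : ℝ :=
  ⨆ π : Finpartition (⊤ : 𝒜), ‖∑ A ∈ π.parts, |F.1 A|‖

/-- `H` is the modulus `|F|`: the supremum of `{F, -F}` in the ordered space `ba₀(𝒜, X)`. -/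
def IsModulus {Ω : Type*} {𝒜 : BooleanSubalgebra (Set Ω)} {X : Type*} [NormedAddCommGroup X]
    [Lattice X] [HasSolidNorm X] [IsOrderedAddMonoid X] [NormedSpace ℝ X] [IsOrderedModule ℝ X]
    (F H : ba0 𝒜 X) : Prop :=
  IsLUB {F, -F} H

/-- The function `sup_{A ∈ π} F(A) / l(A)` on `W`, for `F` with values in `L¹(P)₊` and `l ≥ 0`.
It is `[0, ∞]`-valued, with `0 / 0 = 0` and `c / 0 = ∞` for `c > 0`. -/
def supRatio {Ω W : Type*} [MeasurableSpace W] {P : Measure W} {𝒜 : BooleanSubalgebra (Set Ω)}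
    (F : 𝒜 → Lp ℝ 1 P) (l : 𝒜 → ℝ) (π : Finpartition (⊤ : 𝒜)) : W → ℝ≥0∞ :=
  fun w => ⨆ A ∈ π.parts, ENNReal.ofReal (F A w) / ENNReal.ofReal (l A)

/-- A set of `[0, ∞]`-valued functions is bounded in `P`-probability:
`lim_{c → ∞} sup_{f ∈ R} P(f > c) = 0`. -/
def IsPBounded {W : Type*} [MeasurableSpace W] (P : Measure W) (R : Set (W → ℝ≥0∞)) : Prop :=
  ∀ ε : ℝ≥0∞, 0 < ε → ∃ c : ℝ≥0, ∀ f ∈ R, P {w | (c : ℝ≥0∞) < f w} ≤ ε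

end

/-! Two convexity arguments tame the sequence, both driven by `exists_approx_midpoint_minimizers`:
almost minimising a bounded functional over the shrinking sets of forward convex combinations makes
its midpoint defect small, and here that defect controls a quadratic distance.

Weight (`exists_forward_convex_weight`). The ratios grow under refinement, so F_n ≤ h_n·λ with h_n
their essential supremum, finite a.e. by P-boundedness. Almost minimise ∫ exp(-h) over convex
combinations of the pairs (F_n, h_n). The midpoint defect is half the squared L² distance of the
functions exp(-h/2), so these converge a.e. along the chosen pairs; a limit 0 would mean h → ∞,
which P-boundedness excludes almost surely. The chosen h are therefore bounded a.e., and a single v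
> 0 gives v·G_n ≤ λ for all n.

Energy (`exists_forward_convex_weighted_cauchy`). Now sup_π Σ ∫ (vG(A))² dP / λ(A) ≤ 1, and this
behaves as a squared Hilbert norm. The parallelogram law makes almost minimisers y_n Cauchy, and a
Cauchy–Schwarz estimate bounds the v-weighted variation of y_n - y_{n+1} by 2⁻ⁿ.

Limit. The moduli exist as L¹ limits over refining partitions (`exists_isModulus`). Since v > 0
a.e., Σ |y_n - y_{n+1}|(Ω) converges a.e. Thus y_n(A) has an a.e. limit ξ(A), integrable by Fatou,
and |y_n - ξ|(Ω) is at most the tail of that series. -/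

/-! ### Subadditive functions and refinement of partitions -/

section Partitions

variable {α Y : Type*} [BooleanAlgebra α] [AddCommMonoid Y] [PartialOrder Y] [IsOrderedAddMonoid Y]

theorem subadditive_sup_le_sum {φ : α → Y} (h0 : φ ⊥ ≤ 0)
    (hφ : ∀ A B, Disjoint A B → φ (A ⊔ B) ≤ φ A + φ B) (s : Finset α)
    (hs : (s : Set α).PairwiseDisjoint id) : φ (s.sup id) ≤ ∑ A ∈ s, φ A := by
  classical
  induction s using Finset.induction_on with
  | empty => simpa using h0
  | insert a s ha ih =>
    rw [Finset.sup_insert, Finset.sum_insert ha, id]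
    refine (hφ _ _ ?_).trans (by
      gcongr
      exact ih (hs.subset (by simp)))
    rw [Finset.disjoint_sup_right]
    intro b hb
    exact hs (by simp) (by simp [hb]) (by rintro rfl; exact ha hb)

theorem Finpartition.subadditive_le_sum {φ : α → Y} (h0 : φ ⊥ ≤ 0)
    (hφ : ∀ A B, Disjoint A B → φ (A ⊔ B) ≤ φ A + φ B) {a : α} (π : Finpartition a) :
    φ a ≤ ∑ A ∈ π.parts, φ A := by
  have := subadditive_sup_le_sum h0 hφ π.parts π.disjoint
  rwa [π.sup_parts] at this

/-- Grouping the finer parts by the coarser part containing them, each group has that part as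
supremum; subadditivity applies group by group. -/
theorem Finpartition.sum_le_sum_of_le {φ : α → Y} (h0 : φ ⊥ ≤ 0)
    (hφ : ∀ A B, Disjoint A B → φ (A ⊔ B) ≤ φ A + φ B) {a : α} {π π' : Finpartition a}
    (h : π ≤ π') : ∑ A ∈ π'.parts, φ A ≤ ∑ B ∈ π.parts, φ B := by
  classical
  choose! g hg hle using fun B (hB : B ∈ π.parts) => h hB
  rw [← Finset.sum_fiberwise_of_maps_to hg]
  refine Finset.sum_le_sum fun A hA => ?_
  have hsup : ({B ∈ π.parts | g B = A} : Finset α).sup id = A := by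
    apply le_antisymm
    · refine Finset.sup_le fun B hB => ?_
      rw [Finset.mem_filter] at hB
      exact hB.2 ▸ hle B hB.1
    · have h1 : A ≤ π.parts.sup id := by rw [π.sup_parts]; exact π'.le hA
      refine (le_inf le_rfl h1).trans ?_
      rw [Finset.sup_inf_distrib_left]
      refine Finset.sup_le fun B hB => ?_
      by_cases hgB : g B = A
      · exact inf_le_right.trans (Finset.le_sup (f := id) (by simp [hB, hgB]))
      · have : Disjoint A (g B) := π'.disjoint hA (hg B hB) (Ne.symm hgB)
        exact (this.mono_right (hle B hB)).le_bot.trans bot_le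
  have := subadditive_sup_le_sum h0 hφ {B ∈ π.parts | g B = A} (π.disjoint.subset fun B hB => (Finset.mem_filter.1 hB).1)
  rwa [hsup] at this

end Partitions

/-! ### Approximate minimisers and integral estimates -/

/-- The infima of `J` over `K n` increase to some S. Near-minimisers chosen far enough out have `J ≤
S + δ n / 2`, while their midpoints, staying in a late `K`, have `J ≥ S - δ n / 2`. -/
theorem exists_approx_midpoint_minimizers {T : Type*} (K : ℕ → Set T) (hK : Antitone K)
    (hne : ∀ n, (K n).Nonempty) (mid : T → T → T)
    (hmid : ∀ n, ∀ x ∈ K n, ∀ y ∈ K n, mid x y ∈ K n) (J : T → ℝ)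
    (hJ0 : ∀ x ∈ K 0, 0 ≤ J x) (hJ1 : ∀ x ∈ K 0, J x ≤ 1) (δ : ℕ → ℝ) (hδ : ∀ n, 0 < δ n)
    (hδa : Antitone δ) :
    ∃ y : ℕ → T, (∀ n, y n ∈ K n) ∧
      ∀ n m, n ≤ m → (J (y n) + J (y m)) / 2 - J (mid (y n) (y m)) ≤ δ n := by
  have hK0 : ∀ n, K n ⊆ K 0 := fun n => hK (Nat.zero_le n)
  set I : ℕ → ℝ := fun n => sInf (J '' K n) with hI
  have hbb : ∀ n, BddBelow (J '' K n) := fun n =>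
    ⟨0, by rintro _ ⟨x, hx, rfl⟩; exact hJ0 x (hK0 n hx)⟩
  have hle : ∀ n, ∀ x ∈ K n, I n ≤ J x := fun n x hx => csInf_le (hbb n) ⟨x, hx, rfl⟩
  have hI1 : ∀ n, I n ≤ 1 := fun n => by
    obtain ⟨x, hx⟩ := hne n
    exact (hle n x hx).trans (hJ1 x (hK0 n hx))
  have hbI : BddAbove (Set.range I) := ⟨1, by rintro _ ⟨n, rfl⟩; exact hI1 n⟩
  have hImono : Monotone I := fun n m h =>
    csInf_le_csInf (hbb n) ((hne m).image _) (Set.image_mono (hK h))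
  have hk : ∀ n, ∃ k, n ≤ k ∧ (⨆ n, I n) - δ n / 2 < I k := fun n => by
    obtain ⟨k, hk⟩ := exists_lt_of_lt_ciSup (f := I) (b := (⨆ n, I n) - δ n / 2)
      (by linarith [hδ n])
    exact ⟨max n k, le_max_left _ _, hk.trans_le (hImono (le_max_right _ _))⟩
  choose k hnk hk using hk
  have hy : ∀ n, ∃ y ∈ K (k n), J y < I (k n) + δ n / 2 := fun n => by
    obtain ⟨_, ⟨y, hy, rfl⟩, h⟩ := exists_lt_of_csInf_lt ((hne (k n)).image J)
      (show sInf (J '' K (k n)) < I (k n) + δ n / 2 by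
        change I (k n) < _; linarith [hδ n])
    exact ⟨y, hy, h⟩
  choose y hyK hy using hy
  refine ⟨y, fun n => hK (hnk n) (hyK n), fun n m hnm => ?_⟩
  have e1 := hδa hnm
  have e2 := le_ciSup hbI (k n)
  have e3 := le_ciSup hbI (k m)
  have e4 : (⨆ n, I n) - δ n / 2 ≤ J (mid (y n) (y m)) := by
    rcases le_total (k n) (k m) with h | h
    · exact (hk n).le.trans (hle _ _ (hmid _ _ (hyK n) _ (hK h (hyK m))))
    · have := (hk m).le.trans (hle _ _ (hmid _ _ (hK h (hyK n)) _ (hyK m)))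
      linarith
  linarith [hy n, hy m]

theorem ae_summable_of_integral_le {W : Type*} [MeasurableSpace W] {P : Measure W}
    {g : ℕ → W → ℝ} (hg : ∀ k, Integrable (g k) P) (h0 : ∀ k, 0 ≤ᵐ[P] g k)
    {c : ℕ → ℝ} (hc : Summable c) (hgc : ∀ k, ∫ w, g k w ∂P ≤ c k) :
    ∀ᵐ w ∂P, Summable fun k => g k w := by
  have h1 : ∫⁻ w, ∑' k, ENNReal.ofReal (g k w) ∂P ≠ ∞ := by
    rw [lintegral_tsum fun k => (hg k).aemeasurable.ennreal_ofReal]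
    have : ∀ k, ∫⁻ w, ENNReal.ofReal (g k w) ∂P ≤ ENNReal.ofReal (c k) := fun k => by
      rw [← ofReal_integral_eq_lintegral_ofReal (hg k) (h0 k)]
      exact ENNReal.ofReal_le_ofReal (hgc k)
    refine ne_top_of_le_ne_top hc.tsum_ofReal_ne_top (ENNReal.tsum_le_tsum this)
  have h2 := ae_lt_top' (AEMeasurable.tsum fun k => (hg k).aemeasurable.ennreal_ofReal) h1
  filter_upwards [h2, ae_all_iff.2 h0] with w hw hw0
  have := ENNReal.summable_toReal hw.ne
  refine this.congr fun k => ?_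
  rw [ENNReal.toReal_ofReal (hw0 k)]

/-- Integrates |f| ≤ f²/(2t) + t/2, which is (|f| - t)² ≥ 0. -/
theorem integral_abs_le_of_integral_sq_le {W : Type*} [MeasurableSpace W] {P : Measure W}
    [IsProbabilityMeasure P] {f : W → ℝ} (hf : Integrable f P)
    (hf2 : Integrable (fun w => f w ^ 2) P) {t : ℝ} (ht : 0 < t)
    (h : ∫ w, f w ^ 2 ∂P ≤ t ^ 2) : ∫ w, |f w| ∂P ≤ t := by
  have h1 : ∫ w, |f w| ∂P ≤ ∫ w, (f w ^ 2 / (2 * t) + t / 2) ∂P := by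
    refine integral_mono hf.abs ((hf2.div_const _).add (integrable_const _)) fun w => ?_
    have : 0 ≤ (|f w| - t) ^ 2 / (2 * t) := by positivity
    have e : (|f w| - t) ^ 2 / (2 * t) = f w ^ 2 / (2 * t) + t / 2 - |f w| := by
      rw [sub_sq, sq_abs]; field_simp; ring
    change |f w| ≤ f w ^ 2 / (2 * t) + t / 2
    linarith
  rw [integral_add (hf2.div_const _) (integrable_const _), integral_div] at h1
  simp only [integral_const, probReal_univ, one_smul] at h1
  have : (∫ w, f w ^ 2 ∂P) / (2 * t) ≤ t ^ 2 / (2 * t) := by gcongr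
  have e : t ^ 2 / (2 * t) = t / 2 := by field_simp
  linarith

/-! ### Finite additivity over partitions -/

section FinAdd

variable {Ω : Type*} {𝒜 : BooleanSubalgebra (Set Ω)}

theorem IsFinAdd.map_bot {X : Type*} [AddGroup X] {F : 𝒜 → X} (hF : IsFinAdd F) : F ⊥ = 0 := by
  simpa using hF ⊥ ⊥ disjoint_bot_left

/-- The subadditive inequality, applied to both `F` and `-F`. -/
theorem IsFinAdd.sum_inf {X : Type*} [AddCommGroup X] [PartialOrder X] [IsOrderedAddMonoid X]
    {F : 𝒜 → X} (hF : IsFinAdd F) (A : 𝒜) (π : Finpartition (⊤ : 𝒜)) :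
    ∑ B ∈ π.parts, F (A ⊓ B) = F A := by
  have h0 : F (A ⊓ ⊥) = 0 := by rw [inf_bot_eq, hF.map_bot]
  have hadd : ∀ B C, Disjoint B C → F (A ⊓ (B ⊔ C)) = F (A ⊓ B) + F (A ⊓ C) := fun B C h => by
    rw [inf_sup_left, hF _ _ (h.mono inf_le_right inf_le_right)]
  have h1 := π.subadditive_le_sum (φ := fun B => F (A ⊓ B)) h0.le fun B C h => (hadd B C h).le
  have h2 := π.subadditive_le_sum (φ := fun B => -F (A ⊓ B)) (by rw [h0, neg_zero])
    fun B C h => by rw [hadd B C h, neg_add]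
  rw [Finset.sum_neg_distrib, neg_le_neg_iff] at h2
  simp only [inf_top_eq] at h1 h2
  exact le_antisymm h2 h1

theorem IsFinAdd.sum_parts {X : Type*} [AddCommGroup X] [PartialOrder X] [IsOrderedAddMonoid X]
    {F : 𝒜 → X} (hF : IsFinAdd F) (π : Finpartition (⊤ : 𝒜)) :
    ∑ B ∈ π.parts, F B = F ⊤ := by
  simpa using hF.sum_inf ⊤ π

end FinAdd

/-! ### Monotone nets in L¹ and existence of the modulus -/

theorem MeasureTheory.Lp.norm_sub_of_le {W : Type*} [MeasurableSpace W] {P : Measure W} {f g : Lp ℝ 1 P}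
    (h : f ≤ g) : ‖g - f‖ = ∫ w, g w ∂P - ∫ w, f w ∂P := by
  rw [L1.norm_eq_integral_norm, ← integral_sub (L1.integrable_coeFn g) (L1.integrable_coeFn f)]
  refine integral_congr_ae ?_
  filter_upwards [Lp.coeFn_sub g f, (Lp.coeFn_le f g).2 h] with w h1 h2
  rw [h1, Pi.sub_apply, Real.norm_eq_abs, abs_of_nonneg (sub_nonneg.2 h2)]

/-- For ordered elements the distance is a difference of integrals, so convergence of the integrals
makes the net Cauchy; the index set need not be countable. -/
theorem MeasureTheory.Lp.exists_tendsto_of_monotone_of_norm_le {W ι : Type*} [MeasurableSpace W] {P : Measure W}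
    [SemilatticeSup ι] [Nonempty ι] {f : ι → Lp ℝ 1 P} (hf : Monotone f) {C : ℝ}
    (hC : ∀ i, ‖f i‖ ≤ C) : ∃ L, Tendsto f atTop (𝓝 L) := by
  apply cauchySeq_tendsto_of_complete
  set I : ι → ℝ := fun i => ∫ w, f i w ∂P with hI
  have hIC : ∀ i, I i ≤ C := fun i =>
    ((le_abs_self _).trans ((norm_integral_le_integral_norm (f i)).trans_eq
      (L1.norm_eq_integral_norm (f i)).symm)).trans (hC i)
  have hb : BddAbove (Set.range I) := ⟨C, by rintro _ ⟨i, rfl⟩; exact hIC i⟩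
  rw [Metric.cauchySeq_iff']
  intro ε hε
  obtain ⟨N, hN⟩ := exists_lt_of_lt_ciSup (f := I) (b := (⨆ i, I i) - ε) (by linarith)
  refine ⟨N, fun n hn => ?_⟩
  rw [dist_eq_norm_sub, Lp.norm_sub_of_le (hf hn)]
  have := le_ciSup hb n
  change I n - I N < ε
  linarith

section Modulus

variable {Ω W : Type*} {𝒜 : BooleanSubalgebra (Set Ω)} [MeasurableSpace W] {P : Measure W}

/-- A positive finitely additive set function belongs to `ba₀`. -/
theorem mem_ba0_of_nonneg {F : 𝒜 → Lp ℝ 1 P} (hF : IsFinAdd F) (h0 : ∀ A, 0 ≤ F A) :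
    F ∈ ba0 𝒜 (Lp ℝ 1 P) := by
  refine ⟨hF, ‖F ⊤‖, fun π => ?_⟩
  rw [Finset.sum_congr rfl fun A _ => abs_of_nonneg (h0 A), hF.sum_parts π]

theorem antitone_sum_abs_inf {F : 𝒜 → Lp ℝ 1 P} (hF : IsFinAdd F) (A : 𝒜) :
    Antitone fun π : Finpartition (⊤ : 𝒜) => ∑ B ∈ π.parts, |F (A ⊓ B)| := fun π π' h => by
  refine Finpartition.sum_le_sum_of_le (φ := fun B => |F (A ⊓ B)|) (by simp [hF.map_bot])
    (fun B C hBC => ?_) h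
  rw [inf_sup_left, hF _ _ (hBC.mono inf_le_right inf_le_right)]
  exact abs_add_le _ _

theorem sum_abs_inf_le_sum_abs {F : 𝒜 → Lp ℝ 1 P} (hF : IsFinAdd F) (A : 𝒜)
    (π : Finpartition (⊤ : 𝒜)) (hπ : ∀ B ∈ π.parts, B ≤ A ∨ Disjoint A B) :
    ∑ B ∈ π.parts, |F (A ⊓ B)| ≤ ∑ B ∈ π.parts, |F B| := by
  refine Finset.sum_le_sum fun B hB => ?_
  rcases hπ B hB with h | h
  · rw [inf_eq_right.2 h]
  · rw [h.eq_bot, hF.map_bot, abs_zero]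
    exact abs_nonneg _

theorem exists_finpartition_split (A : 𝒜) :
    ∃ π : Finpartition (⊤ : 𝒜), ∀ B ∈ π.parts, B ≤ A ∨ Disjoint A B := by
  classical
  -- Erasing `⊥` covers the cases where `A` or its complement is empty.
  refine ⟨Finpartition.ofErase {A, Aᶜ} ?_ (by simp), fun B hB => ?_⟩
  · rw [Finset.supIndep_iff_pairwiseDisjoint]
    intro B hB C hC hne
    simp only [Finset.coe_insert, Finset.coe_singleton, Set.mem_insert_iff,
      Set.mem_singleton_iff] at hB hC
    rcases hB with rfl | rfl <;> rcases hC with rfl | rfl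
    · exact (hne rfl).elim
    · exact disjoint_compl_right
    · exact disjoint_compl_left
    · exact (hne rfl).elim
  · have : B ∈ ({A, Aᶜ} : Finset 𝒜) := Finset.mem_of_mem_erase hB
    simp only [Finset.mem_insert, Finset.mem_singleton] at this
    rcases this with rfl | rfl
    · exact .inl le_rfl
    · exact .inr disjoint_compl_right

theorem eventually_split (A : 𝒜) :
    ∀ᶠ π : Finpartition (⊤ : 𝒜) in atBot, ∀ B ∈ π.parts, B ≤ A ∨ Disjoint A B := by
  obtain ⟨π₀, h₀⟩ := exists_finpartition_split A
  filter_upwards [eventually_le_atBot π₀] with π hπ B hB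
  obtain ⟨C, hC, hBC⟩ := hπ hB
  exact (h₀ C hC).imp hBC.trans fun h => h.mono_right hBC

/-- The sums grow under refinement, i.e. towards `atBot`, and converge in L¹. The limit is additive
because, once the partition splits along `A`, no part meets both of two disjoint sets `A`, `B`. The
limit formula is what later estimates use. -/
theorem exists_isModulus (F : ba0 𝒜 (Lp ℝ 1 P)) :
    ∃ H : ba0 𝒜 (Lp ℝ 1 P), IsModulus F H ∧ ∀ A,
      Tendsto (fun π : Finpartition (⊤ : 𝒜) => ∑ B ∈ π.parts, |F.1 (A ⊓ B)|) atBot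
        (𝓝 (H.1 A)) := by
  classical
  obtain ⟨F, hF, C, hC⟩ := F
  have hex : ∀ A, ∃ L, Tendsto (fun π : Finpartition (⊤ : 𝒜) => ∑ B ∈ π.parts, |F (A ⊓ B)|)
      atBot (𝓝 L) := by
    intro A
    obtain ⟨π₀, h₀⟩ := exists_finpartition_split A
    have hb : ∀ π : Finpartition (⊤ : 𝒜), ‖∑ B ∈ π.parts, |F (A ⊓ B)|‖ ≤ C := by
      intro π
      -- `C` bounds sums over full partitions; the sums cut down to `A` compare with them once the
      -- partition splits along `A`.
      refine le_trans ?_ (hC (π ⊓ π₀))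
      have h1 := antitone_sum_abs_inf hF A (inf_le_left : π ⊓ π₀ ≤ π)
      have h2 := sum_abs_inf_le_sum_abs hF A (π ⊓ π₀) fun B hB => by
        obtain ⟨D, hD, hBD⟩ := (inf_le_right : π ⊓ π₀ ≤ π₀) hB
        exact (h₀ D hD).imp hBD.trans fun h => h.mono_right hBD
      have h3 : 0 ≤ ∑ B ∈ π.parts, |F (A ⊓ B)| := Finset.sum_nonneg fun _ _ => abs_nonneg _
      apply norm_le_norm_of_abs_le_abs
      rw [abs_of_nonneg h3, abs_of_nonneg (h3.trans (h1.trans h2))]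
      exact h1.trans h2
    exact Lp.exists_tendsto_of_monotone_of_norm_le (ι := (Finpartition (⊤ : 𝒜))ᵒᵈ)
      (f := fun π => ∑ B ∈ (OrderDual.ofDual π).parts, |F (A ⊓ B)|)
      (fun π π' h => antitone_sum_abs_inf hF A h) (fun π => hb _)
  choose H hH using hex
  have hHadd : IsFinAdd H := fun A B hAB => by
    refine tendsto_nhds_unique (hH (A ⊔ B)) (((hH A).add (hH B)).congr' ?_)
    filter_upwards [eventually_split A] with π hπ
    rw [← Finset.sum_add_distrib]
    refine Finset.sum_congr rfl fun D hD => ?_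
    rw [inf_sup_right, hF _ _ (hAB.mono inf_le_left inf_le_left)]
    rcases hπ D hD with h | h
    · rw [(hAB.symm.mono_right h).eq_bot, hF.map_bot]; simp
    · rw [h.eq_bot, hF.map_bot]; simp
  have habs : ∀ A, |F A| ≤ H A := fun A => by
    refine ge_of_tendsto (hH A) (Eventually.of_forall fun π => ?_)
    rw [← hF.sum_inf A π]
    exact Finset.le_sum_of_subadditive _ abs_zero.le abs_add_le _ _
  have h0 : ∀ A, 0 ≤ H A := fun A => (abs_nonneg _).trans (habs A)
  refine ⟨⟨H, mem_ba0_of_nonneg hHadd h0⟩, ⟨?_, ?_⟩, hH⟩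
  · rintro K (rfl | rfl)
    · exact fun A => (le_abs_self _).trans (habs A)
    · exact fun A => (neg_le_abs _).trans (habs A)
  · intro K hK A
    have h1 : ∀ B, |F B| ≤ K.1 B := fun B =>
      abs_le'.2 ⟨hK (Set.mem_insert _ _) B, hK (Set.mem_insert_of_mem _ rfl) B⟩
    refine le_of_tendsto (hH A) (Eventually.of_forall fun π => ?_)
    have h2 : ∑ B ∈ π.parts, |F (A ⊓ B)| ≤ ∑ B ∈ π.parts, K.1 (A ⊓ B) :=
      Finset.sum_le_sum fun B _ => h1 _
    rwa [K.2.1.sum_inf A π] at h2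

end Modulus

/-! ### Essential suprema of directed families -/

/-- An almost everywhere directed family of measurable functions has an essential supremum which
is the supremum of an increasing sequence of its members. -/
theorem exists_monotone_seq_ae_le_iSup {W ι : Type*} [MeasurableSpace W] {P : Measure W}
    [IsFiniteMeasure P] [SemilatticeSup ι] [Nonempty ι] {f : ι → W → ℝ≥0∞}
    (hm : ∀ i, Measurable (f i)) (hf : ∀ i j, i ≤ j → f i ≤ᵐ[P] f j) :
    ∃ i : ℕ → ι, Monotone i ∧ ∀ j, f j ≤ᵐ[P] fun w => ⨆ k, f (i k) w := by
  -- The decreasing injection x ↦ (1 + x)⁻¹ of [0, ∞] into [0, 1] keeps integrals finite even where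
  -- the supremum is infinite.
  set a : ι → ℝ≥0∞ := fun i => ∫⁻ w, (1 + f i w)⁻¹ ∂P with ha
  obtain ⟨u, -, hu, huS⟩ := exists_seq_tendsto_sInf (Set.range_nonempty a) (OrderBot.bddBelow _)
  choose j hj using huS
  have hanti : ∀ i i', i ≤ i' → a i' ≤ a i := fun i i' h => lintegral_mono_ae <| by
    filter_upwards [hf i i' h] with w hw
    gcongr
  have key : ∀ (s : ℕ → ι), Monotone s →
      ∫⁻ w, (1 + ⨆ k, f (s k) w)⁻¹ ∂P = ⨅ k, a (s k) := fun s hs => by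
    have h1 : ∀ w, (1 + ⨆ k, f (s k) w)⁻¹ = ⨅ k, (1 + f (s k) w)⁻¹ := fun w => by
      rw [ENNReal.add_iSup, ENNReal.inv_iSup]
    rw [lintegral_congr h1]
    refine lintegral_iInf_ae (fun k => ((hm (s k)).const_add 1).inv) ?_ ?_
    · intro n
      filter_upwards [hf _ _ (hs n.le_succ)] with w hw
      gcongr
    · refine ne_top_of_le_ne_top (measure_ne_top P Set.univ) ?_
      rw [← lintegral_one]
      refine lintegral_mono fun w => ?_
      simp
  refine ⟨partialSups j, (partialSups j).monotone, fun i => ?_⟩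
  have hmono : Monotone fun k => partialSups j k ⊔ i := fun k k' h =>
    sup_le_sup_right ((partialSups j).monotone h) _
  have hle : (fun w => (1 + ⨆ k, f (partialSups j k ⊔ i) w)⁻¹) ≤ᵐ[P]
      fun w => (1 + ⨆ k, f (partialSups j k) w)⁻¹ := by
    filter_upwards [ae_all_iff.2 fun k => hf (partialSups j k) (partialSups j k ⊔ i) le_sup_left]
      with w hw
    gcongr
    exact hw _
  -- Joining `i` to a minimising sequence cannot lower the infimum, so the pointwise inequality
  -- `hle` is an a.e. equality.
  have hint : ∫⁻ w, (1 + ⨆ k, f (partialSups j k) w)⁻¹ ∂P ≤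
      ∫⁻ w, (1 + ⨆ k, f (partialSups j k ⊔ i) w)⁻¹ ∂P := by
    rw [key _ (partialSups j).monotone, key _ hmono]
    have h1 : ⨅ k, a (partialSups j k) ≤ sInf (Set.range a) :=
      ge_of_tendsto' hu fun k => (iInf_le _ k).trans
        ((hanti _ _ (le_partialSups j k)).trans_eq (hj k))
    exact h1.trans (le_iInf fun k => sInf_le ⟨_, rfl⟩)
  have hfin : ∫⁻ w, (1 + ⨆ k, f (partialSups j k ⊔ i) w)⁻¹ ∂P ≠ ∞ := by
    refine ne_top_of_le_ne_top (measure_ne_top P Set.univ) ?_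
    rw [← lintegral_one]
    refine lintegral_mono fun w => ?_
    simp
  have hmeas : AEMeasurable (fun w => (1 + ⨆ k, f (partialSups j k) w)⁻¹) P :=
    ((Measurable.iSup fun k => hm _).const_add 1).inv.aemeasurable
  filter_upwards [ae_eq_of_ae_le_of_lintegral_le hle hfin hmeas hint,
    hf i (partialSups j 0 ⊔ i) le_sup_right] with w h1 h2
  rw [inv_inj, ENNReal.add_right_inj ENNReal.one_ne_top] at h1
  rw [← h1]
  exact h2.trans (le_iSup (fun k => f (partialSups j k ⊔ i) w) 0)

/-- Continuity from below: the strict inequality holds for the supremum only if it holds for some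
`k`. -/
theorem measure_lt_iSup_le {W : Type*} [MeasurableSpace W] {P : Measure W} {r : ℕ → W → ℝ≥0∞}
    (hr : ∀ᵐ w ∂P, Monotone fun k => r k w) {c ε : ℝ≥0∞} (h : ∀ k, P {w | c < r k w} ≤ ε) :
    P {w | c < ⨆ k, r k w} ≤ ε := by
  set N : Set W := {w | Monotone fun k => r k w} with hN
  have hmono : Monotone fun k => {w | c < r k w} ∩ N := fun k k' hk w hw =>
    ⟨lt_of_lt_of_le hw.1 (hw.2 hk), hw.2⟩
  have h1 : P {w | c < ⨆ k, r k w} ≤ P (⋃ k, {w | c < r k w} ∩ N) := by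
    refine measure_mono_ae ?_
    filter_upwards [hr] with w hw hlt
    obtain ⟨k, hk⟩ := lt_iSup_iff.1 (show c < ⨆ k, r k w from hlt)
    exact Set.mem_iUnion.2 ⟨k, hk, hw⟩
  refine h1.trans ?_
  rw [hmono.measure_iUnion]
  exact iSup_le fun k => (measure_mono Set.inter_subset_left).trans (h k)

/-! ### Ratio suprema over partitions -/

section SupRatio

variable {Ω W : Type*} {𝒜 : BooleanSubalgebra (Set Ω)} [MeasurableSpace W] {P : Measure W}
  {F : 𝒜 → Lp ℝ 1 P} {l : 𝒜 → ℝ}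

theorem measurable_supRatio (F : 𝒜 → Lp ℝ 1 P) (l : 𝒜 → ℝ) (π : Finpartition (⊤ : 𝒜)) :
    Measurable (supRatio F l π) :=
  Measurable.biSup _ π.parts.countable_toSet fun A _ =>
    (Lp.stronglyMeasurable (F A)).measurable.ennreal_ofReal.div_const _

theorem supRatio_le_iff {π : Finpartition (⊤ : 𝒜)} {w : W} {s : ℝ≥0∞} (hl : ∀ A, 0 ≤ l A)
    (hs : s ≠ ∞) : supRatio F l π w ≤ s ↔ ∀ A ∈ π.parts, F A w ≤ s.toReal * l A := by
  simp only [supRatio, iSup_le_iff]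
  refine forall₂_congr fun A _ => ?_
  rw [ENNReal.div_le_iff_le_mul (.inr hs) (.inl ENNReal.ofReal_ne_top), ← ENNReal.ofReal_toReal hs,
    ← ENNReal.ofReal_mul ENNReal.toReal_nonneg,
    ENNReal.ofReal_le_ofReal_iff (mul_nonneg ENNReal.toReal_nonneg (hl A)),
    ENNReal.ofReal_toReal hs]

/-- The bounds on the parts inside `A` add up. Quantifying `s` inside the a.e. statement lets it
depend on `w`. -/
theorem ae_le_of_supRatio_le (hF : IsFinAdd F) (hla : IsFinAdd l) (hl : ∀ A, 0 ≤ l A) (A : 𝒜)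
    (π : Finpartition (⊤ : 𝒜)) (hπ : ∀ B ∈ π.parts, B ≤ A ∨ Disjoint A B) :
    ∀ᵐ w ∂P, ∀ s : ℝ≥0∞, s ≠ ∞ → supRatio F l π w ≤ s → F A w ≤ s.toReal * l A := by
  have h1 : ∀ᵐ w ∂P, F A w = ∑ B ∈ π.parts, F (A ⊓ B) w := by
    filter_upwards [Lp.coeFn_finsetSum π.parts fun B => F (A ⊓ B)] with w hw
    rw [← Finset.sum_apply, ← hw, hF.sum_inf A π]
  have h2 : ∀ᵐ w ∂P, F ⊥ w = 0 := by
    rw [hF.map_bot]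
    exact Lp.coeFn_zero _ _ _
  filter_upwards [h1, h2] with w h1 h2 s hs hle
  rw [supRatio_le_iff hl hs] at hle
  rw [h1, ← hla.sum_inf A π, Finset.mul_sum]
  refine Finset.sum_le_sum fun B hB => ?_
  rcases hπ B hB with h | h
  · rw [inf_eq_right.2 h]
    exact hle B hB
  · rw [h.eq_bot, h2]
    exact mul_nonneg ENNReal.toReal_nonneg (hl _)

theorem supRatio_ae_anti (hF : IsFinAdd F) (hla : IsFinAdd l) (hl : ∀ A, 0 ≤ l A)
    {π π' : Finpartition (⊤ : 𝒜)} (h : π ≤ π') : supRatio F l π' ≤ᵐ[P] supRatio F l π := by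
  have h1 : ∀ᵐ w ∂P, ∀ A ∈ π'.parts, ∀ s : ℝ≥0∞, s ≠ ∞ → supRatio F l π w ≤ s →
      F A w ≤ s.toReal * l A := by
    refine (ae_ball_iff π'.parts.countable_toSet).2 fun A hA => ?_
    refine ae_le_of_supRatio_le hF hla hl A π fun B hB => ?_
    obtain ⟨C, hC, hBC⟩ := h hB
    by_cases hAC : C = A
    · exact .inl (hAC ▸ hBC)
    · exact .inr ((π'.disjoint hA hC (Ne.symm hAC)).mono_right hBC)
  filter_upwards [h1] with w hw
  by_cases hs : supRatio F l π w = ∞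
  · rw [hs]; exact le_top
  · exact (supRatio_le_iff hl hs).2 fun A hA => hw A hA _ hs le_rfl

/-- `h` is the essential supremum over all partitions. Realising it along a monotone sequence
transfers the probability bound, hence its finiteness a.e. -/
theorem exists_dominating_iSup_supRatio [IsFiniteMeasure P] (hF : IsFinAdd F) (hla : IsFinAdd l)
    (hl : ∀ A, 0 ≤ l A) (hb : IsPBounded P (Set.range (supRatio F l))) :
    ∃ h : W → ℝ, Measurable h ∧ (∀ w, 0 ≤ h w) ∧ (∀ A, ∀ᵐ w ∂P, F A w ≤ h w * l A) ∧
      ∃ π : ℕ → Finpartition (⊤ : 𝒜), ∀ᵐ w ∂P, Monotone (fun k => supRatio F l (π k) w) ∧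
        ⨆ k, supRatio F l (π k) w = ENNReal.ofReal (h w) := by
  classical
  obtain ⟨π, hπ, hsup⟩ := exists_monotone_seq_ae_le_iSup (P := P)
    (ι := (Finpartition (⊤ : 𝒜))ᵒᵈ) (f := fun π => supRatio F l (OrderDual.ofDual π))
    (fun π => measurable_supRatio F l _) (fun π π' h => supRatio_ae_anti hF hla hl h)
  have hmono : ∀ᵐ w ∂P, Monotone fun k => supRatio F l (OrderDual.ofDual (π k)) w := by
    have : ∀ᵐ w ∂P, ∀ k, supRatio F l (OrderDual.ofDual (π k)) w ≤
        supRatio F l (OrderDual.ofDual (π (k + 1))) w :=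
      ae_all_iff.2 fun k => supRatio_ae_anti hF hla hl (hπ k.le_succ)
    filter_upwards [this] with w hw
    exact monotone_nat_of_le_succ hw
  have htop : ∀ᵐ w ∂P, ⨆ k, supRatio F l (OrderDual.ofDual (π k)) w ≠ ∞ := by
    refine nonpos_iff_eq_zero.1 (le_of_forall_gt_imp_ge_of_dense fun ε hε => ?_)
    obtain ⟨c, hc⟩ := hb ε hε
    refine le_trans (measure_mono fun w hw => ?_)
      (measure_lt_iSup_le hmono (c := c) fun k => hc _ ⟨_, rfl⟩)
    have : ⨆ k, supRatio F l (OrderDual.ofDual (π k)) w = ∞ := not_not.1 hw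
    change (c : ℝ≥0∞) < _
    rw [this]
    exact ENNReal.coe_lt_top
  refine ⟨fun w => (⨆ k, supRatio F l (OrderDual.ofDual (π k)) w).toReal,
    (Measurable.iSup fun k => measurable_supRatio F l _).ennreal_toReal,
    fun w => ENNReal.toReal_nonneg, fun A => ?_, fun k => OrderDual.ofDual (π k), ?_⟩
  · obtain ⟨π₀, h₀⟩ := exists_finpartition_split A
    filter_upwards [htop, hsup (OrderDual.toDual π₀),
      ae_le_of_supRatio_le hF hla hl A π₀ h₀] with w h1 h2 h3
    exact h3 _ h1 h2
  · filter_upwards [htop, hmono] with w h1 h2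
    exact ⟨h2, (ENNReal.ofReal_toReal h1).symm⟩

end SupRatio

/-! ### A common weight for forward convex combinations -/

section Dominated

variable {Ω W : Type*} {𝒜 : BooleanSubalgebra (Set Ω)} [MeasurableSpace W] {P : Measure W}

/-- Pairs of a forward convex combination `G` of the `F m`, `m ≥ n`, and a measurable function `h`
with `G A ≤ h * l A` for all `A`, where `h` is the supremum of an increasing sequence in `R`. -/
def dominatedPairs (F : ℕ → ba0 𝒜 (Lp ℝ 1 P)) (l : 𝒜 → ℝ) (R : Set (W → ℝ≥0∞)) (n : ℕ) :
    Set (ba0 𝒜 (Lp ℝ 1 P) × (W → ℝ)) :=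
  {p | p.1 ∈ convexHull ℝ (F '' Set.Ici n) ∧ Measurable p.2 ∧ (∀ w, 0 ≤ p.2 w) ∧
    (∀ A, ∀ᵐ w ∂P, p.1.1 A w ≤ p.2 w * l A) ∧
    ∃ r : ℕ → W → ℝ≥0∞, (∀ k, r k ∈ R) ∧
      ∀ᵐ w ∂P, Monotone (fun k => r k w) ∧ ⨆ k, r k w = ENNReal.ofReal (p.2 w)}

variable {F : ℕ → ba0 𝒜 (Lp ℝ 1 P)} {l : 𝒜 → ℝ} {R : Set (W → ℝ≥0∞)}

theorem antitone_dominatedPairs : Antitone (dominatedPairs F l R) := fun _ _ h _ hp =>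
  ⟨convexHull_mono (Set.image_mono (Set.Ici_subset_Ici.2 h)) hp.1, hp.2⟩

theorem coeFn_ba0_combo (a b : ℝ) (x y : ba0 𝒜 (Lp ℝ 1 P)) (A : 𝒜) :
    ∀ᵐ w ∂P, (a • x + b • y).1 A w = a * x.1 A w + b * y.1 A w := by
  filter_upwards [Lp.coeFn_add (a • x.1 A) (b • y.1 A), Lp.coeFn_smul a (x.1 A),
    Lp.coeFn_smul b (y.1 A)] with w h1 h2 h3
  simp only [Pi.add_apply, h2, h3, Pi.smul_apply, smul_eq_mul] at h1
  exact h1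

theorem nonneg_of_mem_convexHull_image (hpos : ∀ n, 0 ≤ F n) {s : Set ℕ}
    {G : ba0 𝒜 (Lp ℝ 1 P)} (hG : G ∈ convexHull ℝ (F '' s)) : 0 ≤ G := by
  have hc : Convex ℝ {G : ba0 𝒜 (Lp ℝ 1 P) | 0 ≤ G} := fun x hx y hy a b ha hb _ A =>
    add_nonneg (smul_nonneg ha (hx A)) (smul_nonneg hb (hy A))
  exact convexHull_min (by rintro _ ⟨m, -, rfl⟩; exact hpos m) hc hG

theorem midpoint_mem_dominatedPairs (hR : Convex ℝ≥0 R) (n : ℕ)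
    (x : ba0 𝒜 (Lp ℝ 1 P) × (W → ℝ)) (hx : x ∈ dominatedPairs F l R n)
    (y : ba0 𝒜 (Lp ℝ 1 P) × (W → ℝ)) (hy : y ∈ dominatedPairs F l R n) :
    ((1 / 2 : ℝ) • x + (1 / 2 : ℝ) • y) ∈ dominatedPairs F l R n := by
  obtain ⟨hx1, hx2, hx3, hx4, r, hr, hx5⟩ := hx
  obtain ⟨hy1, hy2, hy3, hy4, s, hs, hy5⟩ := hy
  refine ⟨convex_convexHull ℝ _ hx1 hy1 (by norm_num) (by norm_num) (by norm_num),
    (hx2.const_smul (1 / 2 : ℝ)).add (hy2.const_smul (1 / 2 : ℝ)), fun w => ?_, fun A => ?_,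
    fun k => (1 / 2 : ℝ≥0) • r k + (1 / 2 : ℝ≥0) • s k, fun k => ?_, ?_⟩
  · have := hx3 w
    have := hy3 w
    simp only [Prod.snd_add, Prod.smul_snd, Pi.add_apply, Pi.smul_apply, smul_eq_mul]
    positivity
  · filter_upwards [hx4 A, hy4 A, coeFn_ba0_combo (1 / 2) (1 / 2) x.1 y.1 A] with w h1 h2 h3
    simp only [Prod.snd_add, Prod.smul_snd, Pi.add_apply, Pi.smul_apply, smul_eq_mul,
      Prod.fst_add, Prod.smul_fst]
    rw [h3]
    linarith
  · refine hR (hr k) (hs k) (by positivity) (by positivity) ?_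
    rw [← add_div, one_add_one_eq_two, div_self two_ne_zero]
  · filter_upwards [hx5, hy5] with w h1 h2
    have m1 : Monotone fun k => (1 / 2 : ℝ≥0) • r k w := fun k k' h => by
      simp only [ENNReal.smul_def, smul_eq_mul]
      exact mul_le_mul_right (h1.1 h) _
    have m2 : Monotone fun k => (1 / 2 : ℝ≥0) • s k w := fun k k' h => by
      simp only [ENNReal.smul_def, smul_eq_mul]
      exact mul_le_mul_right (h2.1 h) _
    refine ⟨m1.add m2, ?_⟩
    simp only [Prod.snd_add, Prod.smul_snd, Pi.add_apply, Pi.smul_apply]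
    rw [← ENNReal.iSup_add_iSup_of_monotone m1 m2]
    simp only [ENNReal.smul_def, smul_eq_mul]
    rw [← ENNReal.mul_iSup, ← ENNReal.mul_iSup, h1.2, h2.2,
      ENNReal.ofReal_add (by have := hx3 w; positivity) (by have := hy3 w; positivity),
      ENNReal.ofReal_mul (by norm_num), ENNReal.ofReal_mul (by norm_num)]
    have : ENNReal.ofReal (1 / 2) = ((1 / 2 : ℝ≥0) : ℝ≥0∞) := by
      rw [ENNReal.ofReal, Real.toNNReal_div zero_le_one]
      simp
    rw [this]

/-- A positive limit bounds `h n w`; a zero limit means `h n w → ∞`. The latter forces `c < h n w`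
for all large `n`, an event of measure at most `ε`. -/
theorem ae_bddAbove_of_ae_convergent_exp [IsFiniteMeasure P] {h : ℕ → W → ℝ}
    (hb : ∀ ε : ℝ≥0∞, 0 < ε → ∃ c : ℝ, ∀ n, P {w | c < h n w} ≤ ε)
    (hconv : ∀ᵐ w ∂P, ∃ a, Tendsto (fun n => Real.exp (-h n w / 2)) atTop (𝓝 a)) :
    ∀ᵐ w ∂P, BddAbove (Set.range fun n => h n w) := by
  have hinf : ∀ᵐ w ∂P, ¬ Tendsto (fun n => h n w) atTop atTop := by
    refine nonpos_iff_eq_zero.1 (le_of_forall_gt_imp_ge_of_dense fun ε hε => ?_)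
    obtain ⟨c, hc⟩ := hb ε hε
    have hmono : Monotone fun N => ⋂ n ≥ N, {w | c < h n w} := fun N M hNM =>
      Set.biInter_subset_biInter_left fun n hn => le_trans hNM hn
    have hsub : {w | ¬¬ Tendsto (fun n => h n w) atTop atTop} ⊆
        ⋃ N, ⋂ n ≥ N, {w | c < h n w} := fun w hw => by
      have := (not_not.1 hw).eventually_gt_atTop c
      obtain ⟨N, hN⟩ := eventually_atTop.1 this
      exact Set.mem_iUnion.2 ⟨N, Set.mem_iInter₂.2 hN⟩
    refine (measure_mono hsub).trans ?_
    rw [hmono.measure_iUnion]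
    exact iSup_le fun N => (measure_mono (Set.biInter_subset_of_mem le_rfl)).trans (hc N)
  filter_upwards [hinf, hconv] with w h1 ⟨a, ha⟩
  have ha0 : 0 ≤ a := ge_of_tendsto' ha fun n => (Real.exp_pos _).le
  have e : ∀ n, h n w = -2 * Real.log (Real.exp (-h n w / 2)) := fun n => by
    rw [Real.log_exp]; ring
  rcases ha0.eq_or_lt with rfl | hpos
  · refine (h1 ?_).elim
    have h2 : Tendsto (fun n => Real.exp (-h n w / 2)) atTop (𝓝[>] 0) :=
      tendsto_nhdsWithin_iff.2 ⟨ha, Eventually.of_forall fun n => Real.exp_pos _⟩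
    have h3 := (Real.tendsto_log_nhdsGT_zero.comp h2).const_mul_atBot_of_neg
      (show (-2 : ℝ) < 0 by norm_num)
    exact h3.congr fun n => (e n).symm
  · have h3 := (ha.log hpos.ne').const_mul (-2)
    exact (h3.congr fun n => (e n).symm).bddAbove_range

theorem exists_dominatedPairs_bddAbove [IsProbabilityMeasure P] (hR : Convex ℝ≥0 R)
    (hRb : IsPBounded P R) (hne : ∀ n, (dominatedPairs F l R n).Nonempty) :
    ∃ y : ℕ → ba0 𝒜 (Lp ℝ 1 P) × (W → ℝ), (∀ n, y n ∈ dominatedPairs F l R n) ∧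
      ∀ᵐ w ∂P, BddAbove (Set.range fun n => (y n).2 w) := by
  have hint : ∀ f : W → ℝ, Measurable f → (∀ w, 0 ≤ f w) →
      Integrable (fun w => Real.exp (-f w)) P := fun f hf h0 =>
    Integrable.of_bound (hf.neg.exp.aestronglyMeasurable) 1 <| Eventually.of_forall fun w => by
      rw [Real.norm_eq_abs, abs_of_pos (Real.exp_pos _), Real.exp_le_one_iff]
      linarith [h0 w]
  -- The midpoint defect of ∫ exp(-h) is ∫ (a - a')²/2 with a = exp(-h/2); this `δ` makes the
  -- squared L² distance at most (2⁻ⁿ)².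
  set δ : ℕ → ℝ := fun n => ((1 / 2 : ℝ) ^ n) ^ 2 / 2 with hδ
  have hδa : Antitone δ := fun n m h => by
    simp only [hδ]
    have := pow_le_pow_of_le_one (show (0 : ℝ) ≤ 1 / 2 by norm_num) (by norm_num) h
    gcongr
  obtain ⟨y, hy, hyJ⟩ := exists_approx_midpoint_minimizers (dominatedPairs F l R)
    antitone_dominatedPairs hne (fun x y => (1 / 2 : ℝ) • x + (1 / 2 : ℝ) • y)
    (midpoint_mem_dominatedPairs hR) (fun p => ∫ w, Real.exp (-p.2 w) ∂P)
    (fun p _ => integral_nonneg fun w => (Real.exp_pos _).le)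
    (fun p hp => by
      have := integral_mono (hint p.2 hp.2.1 hp.2.2.1) (integrable_const (1 : ℝ)) fun w =>
        show Real.exp (-p.2 w) ≤ 1 by
          rw [Real.exp_le_one_iff]; linarith [hp.2.2.1 w]
      simpa using this)
    δ (fun n => by positivity) hδa
  refine ⟨y, hy, ae_bddAbove_of_ae_convergent_exp (fun ε hε => ?_) ?_⟩
  · obtain ⟨c, hc⟩ := hRb ε hε
    refine ⟨c, fun n => ?_⟩
    obtain ⟨-, -, h0, -, r, hr, hrs⟩ := hy n
    refine le_trans (measure_mono_ae ?_)
      (measure_lt_iSup_le (hrs.mono fun w h => h.1) (c := c) fun k => hc _ (hr k))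
    filter_upwards [hrs] with w hw hlt
    change (c : ℝ≥0∞) < ⨆ k, r k w
    rw [hw.2, ← ENNReal.ofReal_coe_nnreal]
    exact (ENNReal.ofReal_lt_ofReal_iff (lt_of_le_of_lt c.coe_nonneg hlt)).2 hlt
  · set a : ℕ → W → ℝ := fun n w => Real.exp (-(y n).2 w / 2) with ha
    have ham : ∀ n, Measurable (a n) := fun n => ((hy n).2.1.neg.div_const 2).exp
    have hab : ∀ n w, a n w ∈ Set.Icc (0 : ℝ) 1 := fun n w => by
      refine ⟨(Real.exp_pos _).le, ?_⟩
      simp only [ha]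
      rw [Real.exp_le_one_iff]; linarith [(hy n).2.2.1 w]
    have hai : ∀ n, Integrable (fun w => a n w - a (n + 1) w) P := fun n =>
      Integrable.of_bound ((ham n).sub (ham _)).aestronglyMeasurable 1 <|
        Eventually.of_forall fun w => by
          rw [Real.norm_eq_abs, abs_le]
          have := hab n w
          have := hab (n + 1) w
          simp only [Set.mem_Icc] at *
          constructor <;> linarith
    have hai2 : ∀ n, Integrable (fun w => (a n w - a (n + 1) w) ^ 2) P := fun n =>
      Integrable.of_bound (((ham n).sub (ham _)).pow_const 2).aestronglyMeasurable 1 <|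
        Eventually.of_forall fun w => by
          rw [Real.norm_eq_abs, abs_of_nonneg (sq_nonneg _), sq_le_one_iff_abs_le_one, abs_le]
          have := hab n w
          have := hab (n + 1) w
          simp only [Set.mem_Icc] at *
          constructor <;> linarith
    have hle : ∀ n, ∫ w, |a n w - a (n + 1) w| ∂P ≤ (1 / 2 : ℝ) ^ n := fun n => by
      refine integral_abs_le_of_integral_sq_le (hai n) (hai2 n) (by positivity) ?_
      have h1 := hyJ n (n + 1) n.le_succ
      have h2 := midpoint_mem_dominatedPairs hR n _ (hy n) _
        (antitone_dominatedPairs n.le_succ (hy (n + 1)))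
      have i1 := hint _ (hy n).2.1 (hy n).2.2.1
      have i2 := hint _ (hy (n + 1)).2.1 (hy (n + 1)).2.2.1
      have i3 : Integrable (fun w =>
          (Real.exp (-(y n).2 w) + Real.exp (-(y (n + 1)).2 w)) / 2) P := (i1.add i2).div_const 2
      rw [← integral_add i1 i2, ← integral_div, ← integral_sub i3 (hint _ h2.2.1 h2.2.2.1)] at h1
      have h3 : ∀ w, (Real.exp (-(y n).2 w) + Real.exp (-(y (n + 1)).2 w)) / 2 -
          Real.exp (-((1 / 2 : ℝ) • y n + (1 / 2 : ℝ) • y (n + 1)).2 w) =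
          (a n w - a (n + 1) w) ^ 2 / 2 := fun w => by
        have e1 : ∀ m, Real.exp (-(y m).2 w) = a m w ^ 2 := fun m => by
          simp only [ha]
          rw [← Real.exp_nat_mul]; congr 1; push_cast; ring
        have e2 : Real.exp (-((1 / 2 : ℝ) • y n + (1 / 2 : ℝ) • y (n + 1)).2 w) =
            a n w * a (n + 1) w := by
          simp only [ha]
          rw [← Real.exp_add]; congr 1
          simp only [Prod.snd_add, Prod.smul_snd, Pi.add_apply, Pi.smul_apply, smul_eq_mul]
          ring
        rw [e1, e1, e2]; ring
      rw [integral_congr_ae (Eventually.of_forall h3), integral_div] at h1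
      simp only [hδ] at h1
      linarith
    have hs := ae_summable_of_integral_le (fun n => (hai n).abs)
      (fun n => Eventually.of_forall fun w => abs_nonneg _)
      (summable_geometric_of_lt_one (by norm_num) (by norm_num)) hle
    filter_upwards [hs] with w hw
    refine cauchySeq_tendsto_of_complete (cauchySeq_of_summable_dist ?_)
    simpa only [Real.dist_eq] using hw

theorem exists_forward_convex_weight [IsProbabilityMeasure P] (hpos : ∀ n, 0 ≤ F n)
    (hl : l ∈ FinAddProb 𝒜)
    (hR : IsPBounded P (convexHull ℝ≥0
      {f : W → ℝ≥0∞ | ∃ (n : ℕ) (π : Finpartition (⊤ : 𝒜)), f = supRatio (F n).1 l π})) :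
    ∃ (G : ℕ → ba0 𝒜 (Lp ℝ 1 P)) (v : W → ℝ), (∀ n, G n ∈ convexHull ℝ (F '' Set.Ici n)) ∧
      Measurable v ∧ (∀ w, 0 ≤ v w ∧ v w ≤ 1) ∧ (∀ᵐ w ∂P, 0 < v w) ∧
      ∀ n A, ∀ᵐ w ∂P, v w * (G n).1 A w ≤ l A := by
  obtain ⟨hla, hl0, hl1⟩ := hl
  set R := convexHull ℝ≥0
      {f : W → ℝ≥0∞ | ∃ (n : ℕ) (π : Finpartition (⊤ : 𝒜)), f = supRatio (F n).1 l π} with hRdef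
  have hmem : ∀ n π, supRatio (F n).1 l π ∈ R := fun n π => subset_convexHull _ _ ⟨n, π, rfl⟩
  have hne : ∀ n, (dominatedPairs F l R n).Nonempty := fun n => by
    have hb : IsPBounded P (Set.range (supRatio (F n).1 l)) := fun ε hε => by
      obtain ⟨c, hc⟩ := hR ε hε
      exact ⟨c, by rintro _ ⟨π, rfl⟩; exact hc _ (hmem n π)⟩
    obtain ⟨h, hm, h0, hle, π, hπ⟩ := exists_dominating_iSup_supRatio (F n).2.1 hla hl0 hb
    exact ⟨(F n, h), subset_convexHull _ _ ⟨n, Set.mem_Ici.2 le_rfl, rfl⟩, hm, h0, hle,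
      fun k => supRatio (F n).1 l (π k), fun k => hmem _ _, hπ⟩
  obtain ⟨y, hy, hbd⟩ := exists_dominatedPairs_bddAbove (convex_convexHull _ _) hR hne
  have hy0 : ∀ n w, 0 ≤ (y n).2 w := fun n => (hy n).2.2.1
  have hinv0 : ∀ n w, 0 ≤ (1 + (y n).2 w)⁻¹ := fun n w => by have := hy0 n w; positivity
  have hbb : ∀ w, BddBelow (Set.range fun n => (1 + (y n).2 w)⁻¹) := fun w =>
    ⟨0, by rintro _ ⟨n, rfl⟩; exact hinv0 n w⟩
  -- The summand 1 gives v ≤ 1 and avoids division by zero; the infimum is positive wherever the `h`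
  -- are bounded.
  refine ⟨fun n => (y n).1, fun w => ⨅ n, (1 + (y n).2 w)⁻¹, fun n => (hy n).1,
    Measurable.iInf fun n => ((hy n).2.1.const_add 1).inv, fun w =>
    ⟨Real.iInf_nonneg fun n => hinv0 n w, (ciInf_le (hbb w) 0).trans
      (inv_le_one_of_one_le₀ (by linarith [hy0 0 w]))⟩, ?_, fun n A => ?_⟩
  · filter_upwards [hbd] with w ⟨c, hc⟩
    have hc' : ∀ n, (y n).2 w ≤ c := fun n => hc ⟨n, rfl⟩
    have hc0 : 0 ≤ c := (hy0 0 w).trans (hc' 0)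
    refine lt_of_lt_of_le (show (0 : ℝ) < (1 + c)⁻¹ by positivity) (le_ciInf fun n => ?_)
    have := hc' n
    have := hy0 n w
    gcongr
  · have hG : ∀ᵐ w ∂P, 0 ≤ (y n).1.1 A w := by
      exact (Lp.coeFn_nonneg _).2 (nonneg_of_mem_convexHull_image hpos (hy n).1 A)
    filter_upwards [(hy n).2.2.2.1 A, hG] with w h1 h2
    have h3 := hy0 n w
    have h4 : (⨅ n, (1 + (y n).2 w)⁻¹) ≤ (1 + (y n).2 w)⁻¹ := ciInf_le (hbb w) n
    calc (⨅ n, (1 + (y n).2 w)⁻¹) * (y n).1.1 A w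
        ≤ (1 + (y n).2 w)⁻¹ * ((1 + (y n).2 w) * l A) := by
          gcongr
          nlinarith [hl0 A]
      _ = l A := by field_simp

end Dominated

/-! ### Weighted quadratic energy -/

section Energy

variable {Ω W : Type*} {𝒜 : BooleanSubalgebra (Set Ω)} [MeasurableSpace W] {P : Measure W}

/-- The quadratic density `∫ (v G(A))² dP / l(A)`. -/
noncomputable def weightedEnergy (v : W → ℝ) (l : 𝒜 → ℝ) (G : ba0 𝒜 (Lp ℝ 1 P)) (A : 𝒜) : ℝ :=
  (∫ w, (v w * G.1 A w) ^ 2 ∂P) / l A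

variable {v : W → ℝ} {l : 𝒜 → ℝ} {G G' : ba0 𝒜 (Lp ℝ 1 P)}

theorem aestronglyMeasurable_weight_mul (hv : Measurable v) (G : ba0 𝒜 (Lp ℝ 1 P)) (A : 𝒜) :
    AEStronglyMeasurable (fun w => v w * G.1 A w) P :=
  hv.aestronglyMeasurable.mul (Lp.aestronglyMeasurable _)

theorem integrable_weight_mul [IsFiniteMeasure P] (hv : Measurable v) {A : 𝒜}
    (hG : ∀ᵐ w ∂P, |v w * G.1 A w| ≤ l A) : Integrable (fun w => v w * G.1 A w) P :=
  Integrable.of_bound (aestronglyMeasurable_weight_mul hv G A) (l A) hG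

theorem integrable_weight_mul_sq [IsFiniteMeasure P] (hv : Measurable v) {A : 𝒜}
    (hG : ∀ᵐ w ∂P, |v w * G.1 A w| ≤ l A) : Integrable (fun w => (v w * G.1 A w) ^ 2) P :=
  Integrable.of_bound ((aestronglyMeasurable_weight_mul hv G A).pow 2) (l A ^ 2) <| by
    filter_upwards [hG] with w h
    rw [norm_pow, Real.norm_eq_abs]
    gcongr

/-- Two-term Cauchy–Schwarz. The bounds force a zero numerator over a zero denominator, where `0 / 0
= 0` is the right value. -/
theorem add_sq_div_add_le {a b x y : ℝ} (ha : |a| ≤ x) (hb : |b| ≤ y) :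
    (a + b) ^ 2 / (x + y) ≤ a ^ 2 / x + b ^ 2 / y := by
  rcases ((abs_nonneg a).trans ha).eq_or_lt with rfl | hx
  · have : a = 0 := abs_nonpos_iff.1 ha
    simp [this]
  rcases ((abs_nonneg b).trans hb).eq_or_lt with rfl | hy
  · have : b = 0 := abs_nonpos_iff.1 hb
    simp [this]
  rw [div_add_div _ _ hx.ne' hy.ne', div_le_div_iff₀ (by positivity) (by positivity)]
  nlinarith [sq_nonneg (a * y - b * x)]

theorem abs_le_sq_div_add {a x t : ℝ} (ha : |a| ≤ x) (ht : 0 < t) :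
    |a| ≤ a ^ 2 / x / (2 * t) + t / 2 * x := by
  rcases ((abs_nonneg a).trans ha).eq_or_lt with rfl | hx
  · simpa using ha
  have : 0 ≤ (|a| - t * x) ^ 2 / (x * (2 * t)) := by positivity
  have e : (|a| - t * x) ^ 2 / (x * (2 * t)) = a ^ 2 / x / (2 * t) + t / 2 * x - |a| := by
    rw [sub_sq, sq_abs]; field_simp; ring
  linarith

theorem weightedEnergy_nonneg (hl : ∀ A, 0 ≤ l A) (A : 𝒜) : 0 ≤ weightedEnergy v l G A :=
  div_nonneg (integral_nonneg fun _ => sq_nonneg _) (hl A)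

theorem weightedEnergy_bot (hla : IsFinAdd l) : weightedEnergy v l G ⊥ = 0 := by
  rw [weightedEnergy, hla.map_bot, div_zero]

/-- This makes energy sums grow under refinement. -/
theorem weightedEnergy_sup_le [IsFiniteMeasure P] (hv : Measurable v) (hla : IsFinAdd l)
    (hG : ∀ A, ∀ᵐ w ∂P, |v w * G.1 A w| ≤ l A) (A B : 𝒜) (hAB : Disjoint A B) :
    weightedEnergy v l G (A ⊔ B) ≤ weightedEnergy v l G A + weightedEnergy v l G B := by
  have i := fun A => integrable_weight_mul_sq hv (hG A)
  simp only [weightedEnergy]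
  rw [← integral_div, ← integral_div, ← integral_div,
    ← integral_add ((i A).div_const _) ((i B).div_const _)]
  refine integral_mono_ae ((i _).div_const _) (((i A).div_const _).add ((i B).div_const _)) ?_
  filter_upwards [hG A, hG B, Lp.coeFn_add (G.1 A) (G.1 B)] with w h1 h2 h3
  rw [G.2.1 A B hAB, hla A B hAB, h3, Pi.add_apply, mul_add]
  exact add_sq_div_add_le h1 h2

theorem weightedEnergy_le [IsProbabilityMeasure P] (hv : Measurable v) {A : 𝒜}
    (hG : ∀ᵐ w ∂P, |v w * G.1 A w| ≤ l A) : weightedEnergy v l G A ≤ l A := by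
  have hl : 0 ≤ l A := by
    obtain ⟨w, hw⟩ := hG.exists
    exact (abs_nonneg _).trans hw
  have h1 : ∫ w, (v w * G.1 A w) ^ 2 ∂P ≤ ∫ _, l A * l A ∂P := by
    refine integral_mono_ae (integrable_weight_mul_sq hv hG) (integrable_const _) ?_
    filter_upwards [hG] with w h
    change (v w * G.1 A w) ^ 2 ≤ _
    rw [← sq_abs, ← sq]
    gcongr
  simp only [integral_const, probReal_univ, one_smul] at h1
  exact div_le_of_le_mul₀ hl hl h1

theorem integral_abs_le_weightedEnergy [IsProbabilityMeasure P] (hv : Measurable v) {A : 𝒜}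
    (hG : ∀ᵐ w ∂P, |v w * G.1 A w| ≤ l A) {t : ℝ} (ht : 0 < t) :
    ∫ w, |v w * G.1 A w| ∂P ≤ weightedEnergy v l G A / (2 * t) + t / 2 * l A := by
  have i := integrable_weight_mul_sq hv hG
  have h1 : ∫ w, |v w * G.1 A w| ∂P ≤
      ∫ w, ((v w * G.1 A w) ^ 2 / l A / (2 * t) + t / 2 * l A) ∂P := by
    refine integral_mono_ae (integrable_weight_mul hv hG).abs
      (((i.div_const _).div_const _).add (integrable_const _)) ?_
    filter_upwards [hG] with w h
    exact abs_le_sq_div_add h ht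
  rwa [integral_add ((i.div_const _).div_const _) (integrable_const _), integral_div, integral_div,
    integral_const, probReal_univ, one_smul] at h1

theorem weightedEnergy_parallelogram [IsFiniteMeasure P] (hv : Measurable v) {A : 𝒜}
    (hG : ∀ᵐ w ∂P, |v w * G.1 A w| ≤ l A) (hG' : ∀ᵐ w ∂P, |v w * G'.1 A w| ≤ l A) :
    weightedEnergy v l (G - G') A + 4 * weightedEnergy v l ((1 / 2 : ℝ) • G + (1 / 2 : ℝ) • G') A =
      2 * weightedEnergy v l G A + 2 * weightedEnergy v l G' A := by
  have hsub : ∀ᵐ w ∂P, v w * (G - G').1 A w = v w * G.1 A w - v w * G'.1 A w := by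
    filter_upwards [Lp.coeFn_sub (G.1 A) (G'.1 A)] with w h
    have h' : (G - G').1 A w = G.1 A w - G'.1 A w := h
    rw [h', mul_sub]
  have hmid : ∀ᵐ w ∂P, v w * ((1 / 2 : ℝ) • G + (1 / 2 : ℝ) • G').1 A w =
      (v w * G.1 A w + v w * G'.1 A w) / 2 := by
    filter_upwards [coeFn_ba0_combo (1 / 2) (1 / 2) G G' A] with w h
    rw [h]; ring
  have i1 := integrable_weight_mul_sq hv hG
  have i2 := integrable_weight_mul_sq hv hG'
  have i3 : Integrable (fun w => (v w * G.1 A w) * (v w * G'.1 A w)) P :=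
    (integrable_weight_mul hv hG').bdd_mul (aestronglyMeasurable_weight_mul hv G A) hG
  have i12 : Integrable (fun w => (v w * G.1 A w) ^ 2 + (v w * G'.1 A w) ^ 2) P := i1.add i2
  have e1 : ∫ w, (v w * (G - G').1 A w) ^ 2 ∂P = ∫ w, (v w * G.1 A w) ^ 2 ∂P +
      ∫ w, (v w * G'.1 A w) ^ 2 ∂P - 2 * ∫ w, (v w * G.1 A w) * (v w * G'.1 A w) ∂P := by
    rw [← integral_const_mul, ← integral_add i1 i2, ← integral_sub i12 (i3.const_mul 2)]
    refine integral_congr_ae ?_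
    filter_upwards [hsub] with w h
    rw [h]; ring
  have e2 : 4 * ∫ w, (v w * ((1 / 2 : ℝ) • G + (1 / 2 : ℝ) • G').1 A w) ^ 2 ∂P =
      ∫ w, (v w * G.1 A w) ^ 2 ∂P +
      ∫ w, (v w * G'.1 A w) ^ 2 ∂P + 2 * ∫ w, (v w * G.1 A w) * (v w * G'.1 A w) ∂P := by
    rw [← integral_const_mul, ← integral_const_mul, ← integral_add i1 i2,
      ← integral_add i12 (i3.const_mul 2)]
    refine integral_congr_ae ?_
    filter_upwards [hmid] with w h
    rw [h]; ring
  simp only [weightedEnergy]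
  rw [e1, mul_div_assoc', e2]
  ring

theorem exists_forward_convex_weighted_cauchy [IsProbabilityMeasure P] (hv : Measurable v)
    (hv0 : ∀ w, 0 ≤ v w) (hl : l ∈ FinAddProb 𝒜) (G : ℕ → ba0 𝒜 (Lp ℝ 1 P))
    (hG0 : ∀ n, 0 ≤ G n) (hG : ∀ n A, ∀ᵐ w ∂P, v w * (G n).1 A w ≤ l A) :
    ∃ y : ℕ → ba0 𝒜 (Lp ℝ 1 P), (∀ n, y n ∈ convexHull ℝ (G '' Set.Ici n)) ∧
      ∀ n (π : Finpartition (⊤ : 𝒜)),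
        ∑ A ∈ π.parts, ∫ w, |v w * (y n - y (n + 1)).1 A w| ∂P ≤ (1 / 2 : ℝ) ^ n := by
  classical
  obtain ⟨hla, hl0, hl1⟩ := hl
  set K : ℕ → Set (ba0 𝒜 (Lp ℝ 1 P)) := fun n => convexHull ℝ (G '' Set.Ici n) with hK
  have hKanti : Antitone K := fun n m h =>
    convexHull_mono (Set.image_mono (Set.Ici_subset_Ici.2 h))
  have hb : ∀ x ∈ K 0, ∀ A, ∀ᵐ w ∂P, 0 ≤ v w * x.1 A w ∧ v w * x.1 A w ≤ l A := by
    intro x hx A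
    have hc : Convex ℝ {x : ba0 𝒜 (Lp ℝ 1 P) | ∀ᵐ w ∂P, v w * x.1 A w ≤ l A} := by
      intro x hx y hy a b ha hb hab
      filter_upwards [hx, hy, coeFn_ba0_combo a b x y A] with w h1 h2 h3
      rw [h3]
      calc v w * (a * x.1 A w + b * y.1 A w) = a * (v w * x.1 A w) + b * (v w * y.1 A w) := by ring
        _ ≤ a * l A + b * l A := by gcongr
        _ = l A := by rw [← add_mul, hab, one_mul]
    have h1 : ∀ᵐ w ∂P, v w * x.1 A w ≤ l A :=
      convexHull_min (by rintro _ ⟨m, -, rfl⟩; exact hG m A) hc hx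
    filter_upwards [h1, (Lp.coeFn_nonneg _).2 (nonneg_of_mem_convexHull_image hG0 hx A)] with w h h'
    exact ⟨mul_nonneg (hv0 w) h', h⟩
  have habs : ∀ x ∈ K 0, ∀ A, ∀ᵐ w ∂P, |v w * x.1 A w| ≤ l A := fun x hx A => by
    filter_upwards [hb x hx A] with w h
    rw [abs_of_nonneg h.1]
    exact h.2
  have hsubabs : ∀ x ∈ K 0, ∀ y ∈ K 0, ∀ A, ∀ᵐ w ∂P, |v w * (x - y).1 A w| ≤ l A := by
    intro x hx y hy A
    filter_upwards [hb x hx A, hb y hy A, Lp.coeFn_sub (x.1 A) (y.1 A)] with w h1 h2 h3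
    have h' : (x - y).1 A w = x.1 A w - y.1 A w := h3
    rw [h', mul_sub, abs_le]
    constructor <;> linarith
  have hmid : ∀ n, ∀ x ∈ K n, ∀ y ∈ K n, (1 / 2 : ℝ) • x + (1 / 2 : ℝ) • y ∈ K n :=
    fun n x hx y hy => convex_convexHull ℝ _ hx hy (by norm_num) (by norm_num) (by norm_num)
  set N : ba0 𝒜 (Lp ℝ 1 P) → Finpartition (⊤ : 𝒜) → ℝ :=
    fun x π => ∑ A ∈ π.parts, weightedEnergy v l x A with hN
  have hN0 : ∀ x π, 0 ≤ N x π := fun x π => Finset.sum_nonneg fun A _ => weightedEnergy_nonneg hl0 A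
  have hN1 : ∀ x ∈ K 0, ∀ π, N x π ≤ 1 := fun x hx π =>
    (Finset.sum_le_sum fun A _ => weightedEnergy_le hv (habs x hx A)).trans_eq
      (by rw [hla.sum_parts, hl1])
  have hbdd : ∀ x ∈ K 0, BddAbove (Set.range (N x)) := fun x hx =>
    ⟨1, by rintro _ ⟨π, rfl⟩; exact hN1 x hx π⟩
  have hmono : ∀ x : ba0 𝒜 (Lp ℝ 1 P), (∀ A, ∀ᵐ w ∂P, |v w * x.1 A w| ≤ l A) → Antitone (N x) :=
    fun x hx π π' h => Finpartition.sum_le_sum_of_le (weightedEnergy_bot hla).le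
      (weightedEnergy_sup_le hv hla hx) h
  -- The parallelogram law turns a midpoint defect `δ` into energy 4δ of the difference.
  set δ : ℕ → ℝ := fun n => ((1 / 2 : ℝ) ^ n) ^ 2 / 4 with hδ
  have hδa : Antitone δ := fun n m h => by
    simp only [hδ]
    have := pow_le_pow_of_le_one (show (0 : ℝ) ≤ 1 / 2 by norm_num) (by norm_num) h
    gcongr
  obtain ⟨y, hy, hyJ⟩ := exists_approx_midpoint_minimizers K hKanti
    (fun n => ⟨G n, subset_convexHull _ _ ⟨n, Set.mem_Ici.2 le_rfl, rfl⟩⟩) _ hmid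
    (fun x => ⨆ π, N x π) (fun x _ => Real.iSup_nonneg fun π => hN0 x π)
    (fun x hx => ciSup_le fun π => hN1 x hx π) δ (fun n => by positivity) hδa
  refine ⟨y, hy, fun n π => ?_⟩
  have hy0 : ∀ n, y n ∈ K 0 := fun n => hKanti (Nat.zero_le n) (hy n)
  have hsub := hsubabs _ (hy0 n) _ (hy0 (n + 1))
  have hle : N (y n - y (n + 1)) π ≤ ((1 / 2 : ℝ) ^ n) ^ 2 := by
    -- `ε` pays for a partition nearly attaining the midpoint's energy. On its common refinement
    -- with `π`, neither the midpoint's sum nor that of the difference has decreased.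
    refine le_of_forall_pos_le_add fun ε hε => ?_
    set z := (1 / 2 : ℝ) • y n + (1 / 2 : ℝ) • y (n + 1) with hz
    have hzK : z ∈ K 0 := hmid 0 _ (hy0 n) _ (hy0 (n + 1))
    obtain ⟨π₁, h₁⟩ := exists_lt_of_lt_ciSup (f := N z) (b := (⨆ π, N z π) - ε / 4) (by linarith)
    have h2 := hmono z (habs z hzK) (inf_le_right : π ⊓ π₁ ≤ π₁)
    have h3 := hmono _ hsub (inf_le_left : π ⊓ π₁ ≤ π)
    have h4 : N (y n - y (n + 1)) (π ⊓ π₁) + 4 * N z (π ⊓ π₁) =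
        2 * N (y n) (π ⊓ π₁) + 2 * N (y (n + 1)) (π ⊓ π₁) := by
      simp only [hN, Finset.mul_sum, ← Finset.sum_add_distrib]
      exact Finset.sum_congr rfl fun A _ => weightedEnergy_parallelogram hv
        (habs _ (hy0 n) A) (habs _ (hy0 (n + 1)) A)
    have h5 := le_ciSup (hbdd _ (hy0 n)) (π ⊓ π₁)
    have h6 := le_ciSup (hbdd _ (hy0 (n + 1))) (π ⊓ π₁)
    have h7 := hyJ n (n + 1) n.le_succ
    simp only [hδ] at h7
    linarith
  set t : ℝ := (1 / 2 : ℝ) ^ n with ht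
  have ht0 : 0 < t := by positivity
  -- Cauchy–Schwarz in the form |a| ≤ a²/(2tx) + tx/2, with t² the energy bound and total mass of
  -- `l` equal to 1.
  calc ∑ A ∈ π.parts, ∫ w, |v w * (y n - y (n + 1)).1 A w| ∂P
      ≤ ∑ A ∈ π.parts, (weightedEnergy v l (y n - y (n + 1)) A / (2 * t) + t / 2 * l A) :=
        Finset.sum_le_sum fun A _ => integral_abs_le_weightedEnergy hv (hsub A) ht0
    _ = N (y n - y (n + 1)) π / (2 * t) + t / 2 := by
        rw [Finset.sum_add_distrib, ← Finset.sum_div, ← Finset.mul_sum, hla.sum_parts, hl1, mul_one]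
    _ ≤ t ^ 2 / (2 * t) + t / 2 := by gcongr
    _ = t := by field_simp; ring

end Energy

/-! ### Passage to the almost sure limit -/

section Limit

variable {Ω W : Type*} {𝒜 : BooleanSubalgebra (Set Ω)} [MeasurableSpace W] {P : Measure W}

theorem norm_top_le_ba0Norm {F : ba0 𝒜 (Lp ℝ 1 P)} (hF : 0 ≤ F) : ‖F.1 ⊤‖ ≤ ba0Norm F := by
  obtain ⟨C, hC⟩ := F.2.2
  obtain ⟨π⟩ : Nonempty (Finpartition (⊤ : 𝒜)) := inferInstance
  have h := le_ciSup (f := fun π : Finpartition (⊤ : 𝒜) => ‖∑ A ∈ π.parts, |F.1 A|‖)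
    ⟨C, by rintro _ ⟨π, rfl⟩; exact hC π⟩ π
  rwa [Finset.sum_congr rfl fun A _ => abs_of_nonneg (hF A), F.2.1.sum_parts π] at h

theorem norm_apply_le_norm_top {F : ba0 𝒜 (Lp ℝ 1 P)} (hF : 0 ≤ F) (A : 𝒜) :
    ‖F.1 A‖ ≤ ‖F.1 ⊤‖ := by
  have h := F.2.1 A Aᶜ disjoint_compl_right
  rw [sup_compl_eq_top] at h
  apply norm_le_norm_of_abs_le_abs
  rw [abs_of_nonneg (hF A), abs_of_nonneg (hF ⊤), h]
  exact le_add_of_nonneg_right (hF Aᶜ)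

theorem norm_top_le_of_mem_convexHull {F : ℕ → ba0 𝒜 (Lp ℝ 1 P)} {C : ℝ}
    (hC : ∀ n, ‖(F n).1 ⊤‖ ≤ C) {s : Set ℕ} {G : ba0 𝒜 (Lp ℝ 1 P)}
    (hG : G ∈ convexHull ℝ (F '' s)) : ‖G.1 ⊤‖ ≤ C := by
  have hc : Convex ℝ {G : ba0 𝒜 (Lp ℝ 1 P) | ‖G.1 ⊤‖ ≤ C} := fun x hx y hy a b ha hb hab => by
    refine (norm_add_le (a • x.1 ⊤) (b • y.1 ⊤)).trans ?_
    rw [norm_smul, norm_smul, Real.norm_of_nonneg ha, Real.norm_of_nonneg hb]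
    calc a * ‖x.1 ⊤‖ + b * ‖y.1 ⊤‖ ≤ a * C + b * C := by
          gcongr
          · exact hx
          · exact hy
      _ = C := by rw [← add_mul, hab, one_mul]
  exact convexHull_min (by rintro _ ⟨m, -, rfl⟩; exact hC m) hc hG

theorem coeFn_sum_abs {ι : Type*} (s : Finset ι) (f : ι → Lp ℝ 1 P) :
    ∀ᵐ w ∂P, (∑ B ∈ s, |f B|) w = ∑ B ∈ s, |f B w| := by
  filter_upwards [Lp.coeFn_finsetSum s fun B => |f B|,
    (ae_ball_iff s.countable_toSet).2 fun B _ => Lp.coeFn_abs (f B)] with w h1 h2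
  rw [h1, Finset.sum_apply]
  exact Finset.sum_congr rfl h2

/-- Null sets cannot be united along an uncountable net, so indices with L¹ error below 2⁻ʲ are
selected; along them convergence is a.e. -/
theorem ae_le_of_tendsto_Lp {ι : Type*} {u : Filter ι} [u.NeBot] {S : ι → Lp ℝ 1 P}
    {H : Lp ℝ 1 P} (hS : Tendsto S u (𝓝 H)) {K : W → ℝ} (hK : ∀ i, ∀ᵐ w ∂P, S i w ≤ K w) :
    ∀ᵐ w ∂P, H w ≤ K w := by
  have hex : ∀ j : ℕ, ∃ i, ‖H - S i‖ < (1 / 2 : ℝ) ^ j := fun j => by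
    have h := (Metric.tendsto_nhds.1 hS _ (show (0 : ℝ) < (1 / 2) ^ j by positivity)).exists
    obtain ⟨i, hi⟩ := h
    exact ⟨i, by rwa [dist_comm, dist_eq_norm_sub] at hi⟩
  choose i hi using hex
  have hs := ae_summable_of_integral_le (fun j => (L1.integrable_coeFn (H - S (i j))).norm)
    (fun j => Eventually.of_forall fun w => norm_nonneg _)
    (summable_geometric_of_lt_one (by norm_num) (by norm_num))
    (fun j => (L1.norm_eq_integral_norm (H - S (i j))).symm.trans_le (hi j).le)
  filter_upwards [hs, ae_all_iff.2 fun j => hK (i j),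
    ae_all_iff.2 fun j => Lp.coeFn_sub H (S (i j))] with w h1 h2 h3
  have h4 := h1.tendsto_atTop_zero.add_const (K w)
  rw [zero_add] at h4
  refine ge_of_tendsto' h4 fun j => ?_
  have := le_abs_self ((H - S (i j)) w)
  rw [h3 j, Pi.sub_apply] at this
  rw [h3 j, Real.norm_eq_abs, Pi.sub_apply]
  linarith [h2 j]

theorem integrable_bdd_weight_mul {v : W → ℝ} (hv : Measurable v) (hv01 : ∀ w, 0 ≤ v w ∧ v w ≤ 1)
    (f : Lp ℝ 1 P) : Integrable (fun w => v w * f w) P :=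
  (L1.integrable_coeFn f).bdd_mul (c := 1) hv.aestronglyMeasurable <| Eventually.of_forall fun w => by
    rw [Real.norm_eq_abs, abs_of_nonneg (hv01 w).1]
    exact (hv01 w).2

theorem integral_bdd_weight_mul_le {v : W → ℝ} (hv : Measurable v)
    (hv01 : ∀ w, 0 ≤ v w ∧ v w ≤ 1) (f : Lp ℝ 1 P) : ∫ w, v w * f w ∂P ≤ ‖f‖ := by
  rw [L1.norm_eq_integral_norm]
  refine integral_mono (integrable_bdd_weight_mul hv hv01 f) (L1.integrable_coeFn f).norm fun w => ?_
  have h1 := hv01 w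
  calc v w * f w ≤ v w * ‖f w‖ := by
        gcongr
        · exact h1.1
        · exact le_abs_self _
    _ ≤ 1 * ‖f w‖ := by gcongr; exact h1.2
    _ = ‖f w‖ := one_mul _

/-- Take `V n` to be the modulus of `D n` at `⊤`. The weighted bounds pass to the L¹ limit over
partitions, so Σ v·`V n` converges a.e., and v > 0 can be cancelled. -/
theorem exists_ae_summable_variation_bound {v : W → ℝ} (hv : Measurable v)
    (hv01 : ∀ w, 0 ≤ v w ∧ v w ≤ 1) (hvpos : ∀ᵐ w ∂P, 0 < v w) {D : ℕ → ba0 𝒜 (Lp ℝ 1 P)}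
    (hD : ∀ n (π : Finpartition (⊤ : 𝒜)),
      ∑ A ∈ π.parts, ∫ w, |v w * (D n).1 A w| ∂P ≤ (1 / 2 : ℝ) ^ n) :
    ∃ V : ℕ → Lp ℝ 1 P, (∀ n (π : Finpartition (⊤ : 𝒜)), ∀ᵐ w ∂P,
      ∑ A ∈ π.parts, |(D n).1 A w| ≤ V n w) ∧ (∀ n, 0 ≤ V n) ∧
      ∀ᵐ w ∂P, Summable fun n => V n w := by
  classical
  choose H hH hlim using fun n => exists_isModulus (D n)
  have hlim' : ∀ n, Tendsto (fun π : Finpartition (⊤ : 𝒜) => ∑ B ∈ π.parts, |(D n).1 B|) atBot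
      (𝓝 ((H n).1 ⊤)) := fun n => by simpa only [top_inf_eq] using hlim n ⊤
  have hle : ∀ n (π : Finpartition (⊤ : 𝒜)), ∑ B ∈ π.parts, |(D n).1 B| ≤ (H n).1 ⊤ :=
    fun n π => by
      refine ge_of_tendsto (hlim' n) ?_
      filter_upwards [eventually_le_atBot π] with π' h
      simpa only [top_inf_eq] using antitone_sum_abs_inf (D n).2.1 ⊤ h
  have h0 : ∀ n, 0 ≤ (H n).1 ⊤ := fun n => by
    obtain ⟨π⟩ : Nonempty (Finpartition (⊤ : 𝒜)) := inferInstance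
    exact (Finset.sum_nonneg fun B _ => abs_nonneg _).trans (hle n π)
  refine ⟨fun n => (H n).1 ⊤, fun n π => ?_, h0, ?_⟩
  · filter_upwards [(Lp.coeFn_le _ _).2 (hle n π),
      coeFn_sum_abs π.parts fun B => (D n).1 B] with w h1 h2
    rwa [h2] at h1
  · have hint : ∀ n, ∫ w, v w * (H n).1 ⊤ w ∂P ≤ (1 / 2 : ℝ) ^ n := fun n => by
      have h1 : Tendsto (fun π : Finpartition (⊤ : 𝒜) =>
          ‖(H n).1 ⊤ - ∑ B ∈ π.parts, |(D n).1 B|‖ + (1 / 2 : ℝ) ^ n) atBot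
          (𝓝 (0 + (1 / 2 : ℝ) ^ n)) := by
        refine Tendsto.add_const _ ?_
        have := ((hlim' n).const_sub ((H n).1 ⊤)).norm
        rwa [sub_self, norm_zero] at this
      rw [zero_add] at h1
      refine ge_of_tendsto' h1 fun π => ?_
      set S := ∑ B ∈ π.parts, |(D n).1 B| with hS
      have e1 : ∫ w, v w * (H n).1 ⊤ w ∂P =
          ∫ w, v w * ((H n).1 ⊤ - S) w ∂P + ∫ w, v w * S w ∂P := by
        rw [← integral_add (integrable_bdd_weight_mul hv hv01 _)
          (integrable_bdd_weight_mul hv hv01 _)]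
        refine integral_congr_ae ?_
        filter_upwards [Lp.coeFn_sub ((H n).1 ⊤) S] with w h
        rw [h, Pi.sub_apply]
        ring
      have e2 : ∫ w, v w * S w ∂P = ∑ A ∈ π.parts, ∫ w, |v w * (D n).1 A w| ∂P := by
        rw [← integral_finsetSum _ fun A _ => (integrable_bdd_weight_mul hv hv01 _).abs]
        refine integral_congr_ae ?_
        filter_upwards [coeFn_sum_abs π.parts fun B => (D n).1 B] with w h
        rw [hS, h, Finset.mul_sum]
        exact Finset.sum_congr rfl fun A _ => by rw [abs_mul, abs_of_nonneg (hv01 w).1]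
      rw [e1, e2]
      exact add_le_add (integral_bdd_weight_mul_le hv hv01 _) (hD n π)
    have hs := ae_summable_of_integral_le
      (fun n => integrable_bdd_weight_mul hv hv01 ((H n).1 ⊤))
      (fun n => by
        filter_upwards [(Lp.coeFn_nonneg _).2 (h0 n)] with w h
        exact mul_nonneg (hv01 w).1 h)
      (summable_geometric_of_lt_one (by norm_num) (by norm_num)) hint
    filter_upwards [hs, hvpos] with w h1 h2
    exact (summable_mul_left_iff h2.ne').1 h1

/-- Fatou's lemma puts the limit in L¹; no norm convergence is claimed. -/
theorem exists_Lp_ae_limit {f : ℕ → Lp ℝ 1 P} {C : ℝ} (hC : ∀ n, ‖f n‖ ≤ C)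
    (hf : ∀ᵐ w ∂P, ∃ a, Tendsto (fun n => f n w) atTop (𝓝 a)) :
    ∃ g : Lp ℝ 1 P, ∀ᵐ w ∂P, Tendsto (fun n => f n w) atTop (𝓝 (g w)) := by
  obtain ⟨g, hg, hlim⟩ := exists_stronglyMeasurable_limit_of_tendsto_ae
    (fun n => Lp.aestronglyMeasurable (f n)) hf
  have hmem : MemLp g 1 P := by
    refine ⟨hg.aestronglyMeasurable, ?_⟩
    refine lt_of_le_of_lt (Lp.eLpNorm_lim_le_liminf_eLpNorm
      (fun n => Lp.aestronglyMeasurable (f n)) g hlim) ?_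
    refine lt_of_le_of_lt ?_ (ENNReal.ofReal_lt_top (r := C))
    refine liminf_le_of_frequently_le' (Eventually.of_forall fun n => ?_).frequently
    rw [← ENNReal.ofReal_toReal (Lp.eLpNorm_ne_top (f n)), ← Lp.norm_def]
    exact ENNReal.ofReal_le_ofReal (hC n)
  refine ⟨hmem.toLp g, ?_⟩
  filter_upwards [hlim, hmem.coeFn_toLp] with w h1 h2
  rwa [h2]

/-- Telescoping up to a finite index, then a limit in that index. -/
theorem sum_abs_sub_le_tsum {ι : Type*} {s : Finset ι} {a : ℕ → ι → ℝ} {b : ι → ℝ} {V : ℕ → ℝ}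
    (hV : Summable V) (hV0 : ∀ n, 0 ≤ V n)
    (ha : ∀ n, ∑ i ∈ s, |a n i - a (n + 1) i| ≤ V n)
    (hb : ∀ i ∈ s, Tendsto (fun n => a n i) atTop (𝓝 (b i))) (n : ℕ) :
    ∑ i ∈ s, |a n i - b i| ≤ ∑' k, V (k + n) := by
  have hVn : Summable fun k => V (k + n) := (summable_nat_add_iff n).2 hV
  have h1 : ∀ j, ∑ i ∈ s, |a n i - a (j + n) i| ≤ ∑ k ∈ Finset.range j, V (k + n) := fun j => by
    induction j with
    | zero => simp
    | succ j ih =>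
      rw [Finset.sum_range_succ]
      refine le_trans ?_ (add_le_add ih (ha (j + n)))
      rw [← Finset.sum_add_distrib]
      refine Finset.sum_le_sum fun i _ => ?_
      rw [show j + 1 + n = j + n + 1 by ring]
      exact abs_sub_le _ _ _
  have h2 : Tendsto (fun j => ∑ i ∈ s, |a n i - a (j + n) i|) atTop (𝓝 (∑ i ∈ s, |a n i - b i|)) :=
    tendsto_finsetSum _ fun i hi =>
      (((tendsto_add_atTop_iff_nat n).2 (hb i hi)).const_sub (a n i)).abs
  exact le_of_tendsto' h2 fun j => (h1 j).trans (hVn.sum_le_tsum _ fun k _ => hV0 _)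

/-- For each fixed partition the variation sum of `y n - ξ` is at most the tail of Σ `V k`. This
bound does not depend on the partition, so it survives the L¹ limit defining the modulus. -/
theorem exists_limit_of_summable_variation {y : ℕ → ba0 𝒜 (Lp ℝ 1 P)} (hy0 : ∀ n, 0 ≤ y n)
    {C : ℝ} (hC : ∀ n, ‖(y n).1 ⊤‖ ≤ C) {V : ℕ → Lp ℝ 1 P}
    (hV : ∀ n (π : Finpartition (⊤ : 𝒜)), ∀ᵐ w ∂P,
      ∑ A ∈ π.parts, |(y n - y (n + 1)).1 A w| ≤ V n w)
    (hV0 : ∀ n, 0 ≤ V n) (hVs : ∀ᵐ w ∂P, Summable fun n => V n w) :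
    ∃ ξ : ba0 𝒜 (Lp ℝ 1 P), 0 ≤ ξ ∧ ∃ H : ℕ → ba0 𝒜 (Lp ℝ 1 P),
      (∀ n, IsModulus (y n - ξ) (H n)) ∧
        ∀ᵐ w ∂P, Tendsto (fun n => (H n).1 ⊤ w) atTop (𝓝 0) := by
  classical
  have hsub : ∀ (x z : ba0 𝒜 (Lp ℝ 1 P)) A, ∀ᵐ w ∂P, (x - z).1 A w = x.1 A w - z.1 A w :=
    fun x z A => Lp.coeFn_sub (x.1 A) (z.1 A)
  have hV0' : ∀ᵐ w ∂P, ∀ n, 0 ≤ V n w := ae_all_iff.2 fun n => (Lp.coeFn_nonneg _).2 (hV0 n)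
  have hVy : ∀ π : Finpartition (⊤ : 𝒜), ∀ᵐ w ∂P, ∀ n,
      ∑ A ∈ π.parts, |(y n).1 A w - (y (n + 1)).1 A w| ≤ V n w := fun π => by
    filter_upwards [ae_all_iff.2 fun n => hV n π, ae_all_iff.2 fun n =>
      (ae_ball_iff π.parts.countable_toSet).2 fun A _ => hsub (y n) (y (n + 1)) A] with w h1 h2 n
    rw [← Finset.sum_congr rfl fun A hA => congrArg abs (h2 n A hA)]
    exact h1 n
  have hconv : ∀ A, ∀ᵐ w ∂P, ∃ a, Tendsto (fun n => (y n).1 A w) atTop (𝓝 a) := fun A => by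
    obtain ⟨π, hπ⟩ := exists_finpartition_split A
    have hsum : ∀ᵐ w ∂P, ∀ n, (y n).1 A w = ∑ B ∈ π.parts, (y n).1 (A ⊓ B) w := by
      refine ae_all_iff.2 fun n => ?_
      filter_upwards [Lp.coeFn_finsetSum π.parts fun B => (y n).1 (A ⊓ B)] with w hw
      rw [← Finset.sum_apply, ← hw, (y n).2.1.sum_inf A π]
    have hbot : ∀ᵐ w ∂P, ∀ n, (y n).1 ⊥ w = 0 := ae_all_iff.2 fun n => by
      rw [(y n).2.1.map_bot]
      exact Lp.coeFn_zero _ _ _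
    filter_upwards [hVy π, hVs, hsum, hbot] with w h1 h2 h3 h4
    refine cauchySeq_tendsto_of_complete (cauchySeq_of_summable_dist ?_)
    refine Summable.of_nonneg_of_le (fun n => dist_nonneg) (fun n => ?_) h2
    rw [Real.dist_eq, h3 n, h3 (n + 1), ← Finset.sum_sub_distrib]
    refine (Finset.abs_sum_le_sum_abs _ _).trans ((Finset.sum_le_sum fun B hB => ?_).trans (h1 n))
    rcases hπ B hB with h | h
    · rw [inf_eq_right.2 h]
    · rw [h.eq_bot, h4, h4, sub_self, abs_zero]
      exact abs_nonneg _
  choose ξ hξ using fun A => exists_Lp_ae_limit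
    (fun n => (norm_apply_le_norm_top (hy0 n) A).trans (hC n)) (hconv A)
  have hξadd : IsFinAdd ξ := fun A B hAB => by
    refine Lp.ext ?_
    filter_upwards [hξ A, hξ B, hξ (A ⊔ B), Lp.coeFn_add (ξ A) (ξ B),
      ae_all_iff.2 fun n => Lp.coeFn_add ((y n).1 A) ((y n).1 B)] with w h1 h2 h3 h4 h5
    rw [h4]
    refine tendsto_nhds_unique h3 ((h1.add h2).congr fun n => ?_)
    rw [(y n).2.1 A B hAB, h5 n, Pi.add_apply]
  have hξ0 : ∀ A, 0 ≤ ξ A := fun A => by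
    rw [← Lp.coeFn_nonneg]
    filter_upwards [hξ A, ae_all_iff.2 fun n => (Lp.coeFn_nonneg _).2 (hy0 n A)] with w h1 h2
    exact ge_of_tendsto' h1 h2
  refine ⟨⟨ξ, mem_ba0_of_nonneg hξadd hξ0⟩, hξ0, ?_⟩
  choose H hH hlim using fun n => exists_isModulus (y n - ⟨ξ, mem_ba0_of_nonneg hξadd hξ0⟩)
  refine ⟨H, hH, ?_⟩
  have hle : ∀ᵐ w ∂P, ∀ n, (H n).1 ⊤ w ≤ ∑' k, V (k + n) w := by
    refine ae_all_iff.2 fun n => ae_le_of_tendsto_Lp (hlim n ⊤) fun π => ?_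
    filter_upwards [coeFn_sum_abs π.parts fun B =>
        (y n - ⟨ξ, mem_ba0_of_nonneg hξadd hξ0⟩ : ba0 𝒜 (Lp ℝ 1 P)).1 (⊤ ⊓ B),
      (ae_ball_iff π.parts.countable_toSet).2 fun B _ => hξ B,
      (ae_ball_iff π.parts.countable_toSet).2 fun B _ =>
        hsub (y n) ⟨ξ, mem_ba0_of_nonneg hξadd hξ0⟩ B, hVy π, hVs, hV0'] with w h1 h2 h3 h4 h5 h6
    rw [h1]
    simp only [top_inf_eq]
    rw [Finset.sum_congr rfl fun B hB => congrArg abs (h3 B hB)]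
    exact sum_abs_sub_le_tsum h5 h6 h4 h2 n
  have hH0 : ∀ᵐ w ∂P, ∀ n, 0 ≤ (H n).1 ⊤ w := ae_all_iff.2 fun n =>
    (Lp.coeFn_nonneg _).2 (ge_of_tendsto' (hlim n ⊤) fun π =>
      Finset.sum_nonneg fun B _ => abs_nonneg _)
  filter_upwards [hle, hH0] with w h1 h2
  exact squeeze_zero h2 h1 (tendsto_sum_nat_add fun k => V k w)

end Limit

theorem mainTheorem7 {Ω W : Type*} (𝒜 : BooleanSubalgebra (Set Ω))
    [MeasurableSpace W] (P : Measure W) [IsProbabilityMeasure P]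
    (F : ℕ → ba0 𝒜 (Lp ℝ 1 P)) (hpos : ∀ n, 0 ≤ F n)
    (hbdd : ∃ C : ℝ, ∀ n, ba0Norm (F n) ≤ C)
    (l : 𝒜 → ℝ) (hl : l ∈ FinAddProb 𝒜)
    (hR : IsPBounded P (convexHull ℝ≥0
      {f : W → ℝ≥0∞ | ∃ (n : ℕ) (π : Finpartition (⊤ : 𝒜)), f = supRatio (F n).1 l π})) :
    ∃ ξ : ba0 𝒜 (Lp ℝ 1 P), 0 ≤ ξ ∧
      ∃ G : ℕ → ba0 𝒜 (Lp ℝ 1 P), (∀ n, G n ∈ convexHull ℝ (F '' Set.Ici n)) ∧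
        ∃ H : ℕ → ba0 𝒜 (Lp ℝ 1 P), (∀ n, IsModulus (G n - ξ) (H n)) ∧
          ∀ᵐ w ∂P, Tendsto (fun n => (H n).1 ⊤ w) atTop (𝓝 0) := by
  obtain ⟨C, hC⟩ := hbdd
  obtain ⟨G, v, hG, hv, hv01, hvpos, hvG⟩ := exists_forward_convex_weight hpos hl hR
  obtain ⟨y, hy, hD⟩ := exists_forward_convex_weighted_cauchy hv (fun w => (hv01 w).1) hl G
    (fun n => nonneg_of_mem_convexHull_image hpos (hG n)) hvG
  have hyF : ∀ n, y n ∈ convexHull ℝ (F '' Set.Ici n) := fun n => by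
    -- Forward combinations of the `G m` are again forward combinations of the `F m`.
    refine convexHull_min ?_ (convex_convexHull ℝ _) (hy n)
    rintro _ ⟨m, hm, rfl⟩
    exact convexHull_mono (Set.image_mono (Set.Ici_subset_Ici.2 hm)) (hG m)
  obtain ⟨V, hV, hV0, hVs⟩ := exists_ae_summable_variation_bound hv hv01 hvpos
    (D := fun n => y n - y (n + 1)) hD
  obtain ⟨ξ, hξ, H, hH, hlim⟩ := exists_limit_of_summable_variation
    (fun n => nonneg_of_mem_convexHull_image hpos (hyF n))
    (fun n => norm_top_le_of_mem_convexHull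
      (fun m => (norm_top_le_ba0Norm (hpos m)).trans (hC m)) (hyF n)) hV hV0 hVs
  exact ⟨ξ, hξ, y, hyF, H, hH, hlim⟩
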